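/- All graphs are finite, simple, undirected and connected; $d$ is the graph distance, $I(u,v)=\{x: d(u,x)+d(x,v)=d(u,v)\}$, and $G$ is \emph{median} if for all vertices $x,y,z$ the set $I(x,y)\cap I(y,z)\cap I(z,x)$ is a single vertex $m(x,y,z)$. A vertex $g\in H$ is the \emph{gate} of $v$ in a set $H$ of vertices if $g\in I(v,x)$ for all $x\in H$. \textbf{$\Theta$-classes.} The $\Theta$-classes $E_1,\dots,E_q$ of $G$ are the classes of the equivalence relation on the edges generated by being opposite edges of a square. The two connected components of $G\setminus E_i$ are the halfspaces of $E_i$; $E_i$ is \emph{balanced} if both have at least $n/3$ vertices, $n=|V(G)|$. Let $\mathcal U_3$ be the family of median graphs without balanced $\Theta$-class. The \emph{ladder set} $L_{u,v}$ is the set of $\Theta$-classes that separate $u$ from $v$ and contain an edge incident to $u$. For a basepoint $v_0$ and a set $L$ of $\Theta$-classes, let $V_L=\{v: L_{v_0,v}=L\}$ (so $V_\emptyset=\{v_0\}$). \textbf{The labeling $\Lambda_G$.} The vertices of $G$ have distinct identities in $\{0,\dots,n-1\}$, which they keep in the subgraphs considered in the recursion, and every number below is written on $\lceil\log_2 n\rceil$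 bits, where $n$ is the number of vertices of the initial graph. The labels are bit strings defined by recursion: (a) if the current graph $G$ has at most two vertices, all labels are empty; (b) if $G$ has at least three vertices and a balanced $\Theta$-class, choose one, $E_i$, with halfspaces $H',H''$. The label of $u$ consists of a tag bit, the index $i$, one bit for the side of $u$, the identity of the gate $g(u)$ of $u$ in the opposite halfspace, the distance $d(u,g(u))$, and the label of $u$ in the labeling of the subgraph induced by the halfspace containing $u$; (c) if $G\in\mathcal U_3$ has at least three vertices, let $v_0$ be its median vertex (the vertex minimizing $\sum_x d(v_0,x)$). The label of $v_0$ is empty. The label of $u\ne v_0$, with $L=L_{v_0,u}$, consists of a tag bit, the ladder set $L$ (its size and the list of the indices of its classes), the distance $d(v_0,u)$, for each $E\in L$ the triplet formed by the index of $E$, the identity of the gate $g$ of $u$ in $V_{L\setminus\{E\}}$ and the distance $d(u,g)$, and finally the label of $u$ in the labeling of the subgraph induced by $V_L$. The choice of the balanced classes and the names of their halfspaces, the numbering of the $\Theta$-classes, and the order in which ladder sets are listed are arbitrary. \textbf{Theorem.} 1. Every median graph has such a labeling $\Lambda_G$, for every assignment of identities. 2. There is an algorithm (one program, on a random access machine with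 words of $O(\log n)$ bits, whose instructions and tests take one step each and which accesses the labels only by reading single bits of the label of the vertex of a given identity) which, given $n$ and the identities of two vertices $u,v$, retrieves $d(u,v)$ from any such labeling $\Lambda_G$ of any median graph $G$ with $n$ vertices in time $O(\log^4 n)$. (Explicitly, the time is at most $C(1+\log^4 n)$ for a constant $C$, so that $n=1$ is covered.) 3. Let $G\in\mathcal U_3$ with median vertex $v_0$, let $u,v\in V(G)$, and let $(L^{(-r)},\dots,L^{(0)},\dots,L^{(t)})$ be any ladder sequence from $L^{(-r)}=L_{v_0,u}$ to $L^{(t)}=L_{v_0,v}$: first the classes of $L_{v_0,u}\setminus L_{v_0,v}$ are withdrawn one at a time, until $L^{(0)}=L_{v_0,u}\cap L_{v_0,v}$ is reached, and then the classes of $L_{v_0,v}\setminus L_{v_0,u}$ are added one at a time. Then some shortest $(u,v)$-path passes successively through the fibers $V_{L^{(-r)}},\dots,V_{L^{(t)}}$, and it passes through $V_{L^{(0)}}$ at the vertex $m(u,v,v_0)$. -/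

import Mathlib

universe u

namespace MedianOracle

section Graphs

variable {V : Type u}

/-! ### Median graphs, gates, median vertices -/

/-- The interval `I(u,v)`: the vertices metrically between `u` and `v`. -/
def interval (G : SimpleGraph V) (u v : V) : Set V :=
  {x | G.dist u x + G.dist x v = G.dist u v}

/-- `m` is a median of the triple `x, y, z`. -/
def IsMedianOf (G : SimpleGraph V) (x y z m : V) : Prop :=
  m ∈ interval G x y ∩ interval G y z ∩ interval G z x

/-- Median graphs: connected, and every triple of vertices has exactly one median.  (For triples
with a repeated vertex the condition holds in every connected graph.) -/
structure IsMedianGraph (G : SimpleGraph V) : Prop where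
  connected : G.Connected
  existsUnique_median : ∀ x y z : V, ∃! m : V, IsMedianOf G x y z m

/-- `g` is the gate of `v` in `H`: it lies in `H` and in every interval `I(v,x)`, `x ∈ H`. -/
def IsGate (G : SimpleGraph V) (H : Set V) (v g : V) : Prop :=
  g ∈ H ∧ ∀ x ∈ H, g ∈ interval G v x

/-- `v` minimizes the sum of distances to all vertices. -/
def IsMedianVertex (G : SimpleGraph V) (v : V) : Prop :=
  ∀ x : V, ∑ᶠ y, G.dist v y ≤ ∑ᶠ y, G.dist x y

/-! ### Theta-classes -/

/-- Two edges `ab` and `cd` are opposite edges of a square `a b d c`. -/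
def SquareOpposite (G : SimpleGraph V) (e f : G.edgeSet) : Prop :=
  ∃ a b c d : V, e.1 = s(a, b) ∧ f.1 = s(c, d) ∧ G.Adj a c ∧ G.Adj b d ∧ a ≠ d ∧ b ≠ c

/-- The set of Theta-classes: the classes of the equivalence relation on edges generated by
being opposite in a square. -/
def ThetaClass (G : SimpleGraph V) : Type u := Quot (SquareOpposite G)

variable {G : SimpleGraph V}

/-- The edges belonging to a Theta-class. -/
def ThetaClass.edges (E : ThetaClass G) : Set (Sym2 V) :=
  {e | ∃ h : e ∈ G.edgeSet, Quot.mk (SquareOpposite G) ⟨e, h⟩ = E}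

/-- The graph `G` deprived of the edges of `E`. -/
def ThetaClass.cut (E : ThetaClass G) : SimpleGraph V := G.deleteEdges E.edges

/-- The halfspaces of `E` are the vertex sets of the connected components of `G \ E`. -/
def ThetaClass.IsHalfspace (E : ThetaClass G) (H : Set V) : Prop :=
  ∃ c : E.cut.ConnectedComponent, H = c.supp

/-- `E` is 3-balanced: each of its halfspaces has at least `n / 3` vertices. -/
def ThetaClass.IsBalanced (E : ThetaClass G) : Prop :=
  ∀ H : Set V, E.IsHalfspace H → Nat.card V ≤ 3 * H.ncard

/-- No Theta-class of `G` is 3-balanced (for median graphs: the family `U_3`). -/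
def IsUnbalanced (G : SimpleGraph V) : Prop := ∀ E : ThetaClass G, ¬ E.IsBalanced

/-- The signature: the classes separating `u` from `v`. -/
def signature (G : SimpleGraph V) (u v : V) : Set (ThetaClass G) :=
  {E | ¬ E.cut.Reachable u v}

/-- The ladder set `L_{u,v}`: the classes of the signature having an edge at `u`. -/
def ladder (G : SimpleGraph V) (u v : V) : Set (ThetaClass G) :=
  {E | E ∈ signature G u v ∧ ∃ x : V, s(u, x) ∈ E.edges}

/-- The set `V_L` of vertices whose ladder set from the basepoint `v₀` is `L`. -/
def ladderFiber (G : SimpleGraph V) (v₀ : V) (L : Set (ThetaClass G)) : Set V :=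
  {v | ladder G v₀ v = L}

/-- Ladder sequences `L (-r), …, L (-1), L 0, L 1, …, L t` from `A` to `B`: first the classes of
`A \ B` are withdrawn one at a time until `A ∩ B` is reached, then the classes of `B \ A` are
added one at a time.  The values of `L` outside `[-r, t]` are irrelevant. -/
structure IsLadderSequence {α : Type u} (A B : Set α) (r t : ℕ) (L : ℤ → Set α) : Prop where
  first : L (-(r : ℤ)) = A
  middle : L 0 = A ∩ B
  last : L (t : ℤ) = B
  withdraw : ∀ i : ℕ, i < r →
    ∃ E ∈ L (-((i : ℤ) + 1)) \ B, L (-(i : ℤ)) = L (-((i : ℤ) + 1)) \ {E}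
  add : ∀ j : ℕ, j < t → ∃ E ∈ L ((j : ℤ) + 1) \ A, L (j : ℤ) = L ((j : ℤ) + 1) \ {E}

end Graphs

/-! ### The labeling -/

/-- The number `x` written on `w` bits, most significant bit first. -/
def bits : ℕ → ℕ → List Bool
  | 0, _ => []
  | w + 1, x => x.testBit w :: bits w x

/-- What is written in front of the recursive part of a label when a balanced class is used as a
separator: a tag bit, the index of the class, the side of the vertex, the identity of its gate in
the opposite halfspace and the distance to this gate. -/
def balancedBlock (w index : ℕ) (side : Bool) (gate dist : ℕ) : List Bool :=
  true :: bits w index ++ side :: bits w gate ++ bits w dist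

/-- What is written in front of the recursive part of a label when there is no balanced class: a
tag bit, the ladder set (its size, then the indices of its classes), the distance to the median
vertex and the triplets (index of the withdrawn class, identity of the gate, distance to it). -/
def unbalancedBlock (w : ℕ) (ladderIndices : List ℕ) (dist : ℕ) (triplets : List (ℕ × ℕ × ℕ)) :
    List Bool :=
  false :: bits w ladderIndices.length ++ ladderIndices.flatMap (bits w) ++ bits w dist ++
    triplets.flatMap (fun p => bits w p.1 ++ bits w p.2.1 ++ bits w p.2.2)

/-- `IsLabeling w G ident Λ`: the map `Λ` is a labeling of `G` obtained by the recursive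
construction, where vertex `x` has identity `ident x` and every number is written on `w` bits.
All arbitrary choices (the balanced class and the names of its halfspaces, the numbering of the
classes, the order in which ladder sets are listed) are left free.  In the recursive calls the
vertices of a subgraph keep their identities. -/
inductive IsLabeling (w : ℕ) :
    {V : Type u} → SimpleGraph V → (V → ℕ) → (V → List Bool) → Prop
  /-- At most two vertices: empty labels. -/
  | small {V : Type u} (G : SimpleGraph V) (ident : V → ℕ) (Λ : V → List Bool)
      (card_le : Nat.card V ≤ 2) (label : ∀ x, Λ x = []) : IsLabeling w G ident Λ
  /-- Recursion on the two halfspaces `H₁`, `H₂` of a balanced class `E`. -/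
  | balanced {V : Type u} (G : SimpleGraph V) (ident : V → ℕ) (Λ : V → List Bool)
      (le_card : 3 ≤ Nat.card V)
      (index : ThetaClass G ≃ Fin (Nat.card (ThetaClass G)))
      (E : ThetaClass G) (isBalanced : E.IsBalanced)
      (H₁ H₂ : Set V) (half₁ : E.IsHalfspace H₁) (half₂ : E.IsHalfspace H₂) (compl : H₂ = H₁ᶜ)
      (gate : V → V)
      (gate₁ : ∀ x ∈ H₁, IsGate G H₂ x (gate x)) (gate₂ : ∀ x ∈ H₂, IsGate G H₁ x (gate x))
      (Λ₁ : H₁ → List Bool) (Λ₂ : H₂ → List Bool)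
      (rec₁ : IsLabeling w (G.induce H₁) (fun x => ident x) Λ₁)
      (rec₂ : IsLabeling w (G.induce H₂) (fun x => ident x) Λ₂)
      (label₁ : ∀ (x : V) (hx : x ∈ H₁), Λ x =
        balancedBlock w (index E) false (ident (gate x)) (G.dist x (gate x)) ++ Λ₁ ⟨x, hx⟩)
      (label₂ : ∀ (x : V) (hx : x ∈ H₂), Λ x =
        balancedBlock w (index E) true (ident (gate x)) (G.dist x (gate x)) ++ Λ₂ ⟨x, hx⟩) :
      IsLabeling w G ident Λ
  /-- No balanced class: recursion on the fibers `V_L` for the ladder sets `L ≠ ∅` from the median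
  vertex `v₀`.  Here `gate x E` is the gate of `x` in `V_{L \ {E}}`, where `L` is the ladder
  set of `x` and `E ∈ L`. -/
  | unbalanced {V : Type u} (G : SimpleGraph V) (ident : V → ℕ) (Λ : V → List Bool)
      (le_card : 3 ≤ Nat.card V) (isUnbalanced : IsUnbalanced G)
      (index : ThetaClass G ≃ Fin (Nat.card (ThetaClass G)))
      (v₀ : V) (isMedianVertex : IsMedianVertex G v₀)
      (lad : V → List (ThetaClass G)) (lad_nodup : ∀ x, (lad x).Nodup)
      (mem_lad : ∀ x E, E ∈ lad x ↔ E ∈ ladder G v₀ x)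
      (gate : V → ThetaClass G → V)
      (isGate : ∀ x, ∀ E ∈ ladder G v₀ x,
        IsGate G (ladderFiber G v₀ (ladder G v₀ x \ {E})) x (gate x E))
      (Λr : (L : Set (ThetaClass G)) → ladderFiber G v₀ L → List Bool)
      (recL : ∀ L : Set (ThetaClass G), L.Nonempty →
        IsLabeling w (G.induce (ladderFiber G v₀ L)) (fun x => ident x) (Λr L))
      (label_v₀ : Λ v₀ = [])
      (label : ∀ x : V, x ≠ v₀ → Λ x =
        unbalancedBlock w ((lad x).map fun E => (index E : ℕ)) (G.dist v₀ x)
          ((lad x).map fun E => ((index E : ℕ), ident (gate x E), G.dist x (gate x E))) ++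
        Λr (ladder G v₀ x) ⟨x, rfl⟩) :
      IsLabeling w G ident Λ

/-! ### A word RAM with access to the labels -/

/-- Elementary instructions.  Memory cells contain words; `[a]` is the content of cell `a`. -/
inductive Instr : Type
  /-- `[d] := k` -/
  | const (d k : ℕ)
  /-- `[d] := [a] + [b]` -/
  | add (d a b : ℕ)
  /-- `[d] := [a] - [b]`, or `0` if `[a] < [b]` -/
  | sub (d a b : ℕ)
  /-- `[d] := [[a]]` -/
  | load (d a : ℕ)
  /-- `[[d]] := [a]` -/
  | store (d a : ℕ)
  /-- `[d] :=` the bit number `[b]` of the label of the vertex of identity `[a]`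
  (`2` if that label has no bit of this number) -/
  | probe (d a b : ℕ)

/-- Programs over the elementary instructions. -/
inductive Prog : Type
  | skip
  | instr (i : Instr)
  | seq (P Q : Prog)
  /-- if `[a] ≠ 0` then `P` else `Q` -/
  | cond (a : ℕ) (P Q : Prog)
  /-- while `[a] ≠ 0` do `P` -/
  | loop (a : ℕ) (P : Prog)

/-- Write `x` into cell `d` of a memory with words of `W` bits (overflowing bits are lost). -/
def write (W : ℕ) (s : ℕ → ℕ) (d x : ℕ) : ℕ → ℕ := Function.update s d (x % 2 ^ W)

/-- The bit number `i` of `l` as a number; `2` beyond the end of `l`. -/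
def bitAt (l : List Bool) (i : ℕ) : ℕ :=
  match l[i]? with
  | some true => 1
  | some false => 0
  | none => 2

/-- Effect of an instruction on the memory `s`, where `labels k` is the label of the vertex of
identity `k`. -/
def Instr.exec (W : ℕ) (labels : ℕ → List Bool) (s : ℕ → ℕ) : Instr → (ℕ → ℕ)
  | .const d k => write W s d k
  | .add d a b => write W s d (s a + s b)
  | .sub d a b => write W s d (s a - s b)
  | .load d a => write W s d (s (s a))
  | .store d a => write W s (s d) (s a)
  | .probe d a b => write W s d (bitAt (labels (s a)) (s b))

/-- `Runs W labels P s t s'`: started on the memory `s`, the program `P` halts after exactly `t`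
steps with memory `s'`.  Every elementary instruction and every test takes one step. -/
inductive Runs (W : ℕ) (labels : ℕ → List Bool) :
    Prog → (ℕ → ℕ) → ℕ → (ℕ → ℕ) → Prop
  | skip (s) : Runs W labels .skip s 1 s
  | instr (i s) : Runs W labels (.instr i) s 1 (i.exec W labels s)
  | seq {P Q s₁ s₂ s₃ t₁ t₂} : Runs W labels P s₁ t₁ s₂ → Runs W labels Q s₂ t₂ s₃ →
      Runs W labels (.seq P Q) s₁ (t₁ + t₂) s₃
  | cond_true {a P Q s s' t} : s a ≠ 0 → Runs W labels P s t s' →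
      Runs W labels (.cond a P Q) s (t + 1) s'
  | cond_false {a P Q s s' t} : s a = 0 → Runs W labels Q s t s' →
      Runs W labels (.cond a P Q) s (t + 1) s'
  | loop_true {a P s₁ s₂ s₃ t₁ t₂} : s₁ a ≠ 0 → Runs W labels P s₁ t₁ s₂ →
      Runs W labels (.loop a P) s₂ t₂ s₃ → Runs W labels (.loop a P) s₁ (t₁ + t₂ + 1) s₃
  | loop_false {a P s} : s a = 0 → Runs W labels (.loop a P) s 1 s

/-- Initial memory of a query: the identities of the two vertices and the number of vertices in the
cells `0`, `1`, `2`, and zeros elsewhere. -/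
def queryInput (i j n : ℕ) : ℕ → ℕ
  | 0 => i
  | 1 => j
  | 2 => n
  | _ => 0

/-- The table of labels, accessed through the identities `0, …, n - 1` of the vertices. -/
def labelTable {V : Type u} {n : ℕ} (ident : V ≃ Fin n) (Λ : V → List Bool) (k : ℕ) : List Bool :=
  if h : k < n then Λ (ident.symm ⟨k, h⟩) else []

end MedianOracle

open MedianOracle

namespace MedianOracle

section MedianGraphs

variable {V : Type u} {G : SimpleGraph V}

/-! ### Distances and gates -/

/-! Geometry. In a median graph the Θ-class of an edge `ab` consists exactly of the edges joining
the vertices nearer to `a` to the vertices nearer to `b`, and both sides are convex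
(`mem_edges_iff_crossing`, `isConvex_nearer`). Nonempty convex sets have gates and inherit distances
and medians, so all nonempty subgraphs met in the recursion are median graphs with the distances of
the initial graph.

A class at `v₀` lies in the ladder set of `u` exactly when `u` is across its cut. Statements on
ladder sets thus become statements on halfspaces: fibers are convex, and the median of `u, v, v₀`
has ladder set `L_u ∩ L_v`. If `E ∈ L_u`, the gate of `u` in the halfspace of `v₀` has ladder set
`L_u \ {E}`, and it is the gate stored in the label. Since it is a gate in a whole halfspace, it
lies on a shortest path from `u` to every vertex whose ladder set misses `E`, not only to the
vertices of the target fiber (`gate_mem_interval`). Hence withdrawing the classes outside `L_v` one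
at a time, by jumping from gate to gate, never leaves the shortest paths towards `v`. This yields
both the path along a ladder sequence and the correctness of the query.

Query. The invariant is that the accumulated length plus the distance between the two current
vertices is constant. With a balanced class, one vertex jumps to its gate if the sides differ, and
at most `2n/3` vertices remain. Without one, both vertices walk into the fiber of `L_u ∩ L_v`, which
is `{v₀}` or has at most `n/2` vertices because `v₀` is a median vertex
(`two_mul_ncard_ladderFiber_le`). So there are `O(log n)` levels. Every subset of a ladder set is
again a ladder set, so ladder sets have at most `log₂ n` classes; with `w = ⌈log₂ n⌉`, a level
handles `O(w)` classes, scans `O(w)` numbers of `w` bits for each, and costs `O(w³)`. The total is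
`O(w⁴)`. -/

theorem exists_adj_dist_eq (hG : G.Connected) {x y : V} (h : x ≠ y) :
    ∃ z, G.Adj x z ∧ G.dist x y = G.dist z y + 1 := by
  obtain ⟨p, hp⟩ := hG.exists_walk_length_eq_dist x y
  cases p with
  | nil => exact absurd rfl h
  | @cons _ z _ hxz q =>
    refine ⟨z, hxz, ?_⟩
    have h1 := G.dist_le q
    have h2 := hG.dist_triangle (u := x) (v := z) (w := y)
    rw [SimpleGraph.dist_eq_one_iff_adj.2 hxz] at h2
    rw [SimpleGraph.Walk.length_cons] at hp
    omega

theorem mem_interval {u v x : V} :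
    x ∈ interval G u v ↔ G.dist u x + G.dist x v = G.dist u v := Iff.rfl

theorem interval_comm (u v : V) : interval G u v = interval G v u := by
  ext x
  rw [mem_interval, mem_interval, G.dist_comm (u := v) (v := u), G.dist_comm (u := v) (v := x),
    G.dist_comm (u := x) (v := u), add_comm]

/-- A set of vertices is convex if it contains the intervals between its elements. -/
def IsConvex (G : SimpleGraph V) (S : Set V) : Prop :=
  ∀ x ∈ S, ∀ y ∈ S, interval G x y ⊆ S

theorem IsGate.unique (hG : G.Connected) {S : Set V} {x g g' : V} (h : IsGate G S x g)
    (h' : IsGate G S x g') : g = g' := by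
  have h1 := h.2 g' h'.1
  have h2 := h'.2 g h.1
  rw [mem_interval] at h1 h2
  rw [G.dist_comm (u := g') (v := g)] at h2
  exact hG.dist_eq_zero_iff.1 (by omega)

/-- The gate is a nearest point `g` of `S`: for `y ∈ S` the median of `x, g, y` lies in `S` by
convexity and on a shortest path from `x` to `g`, so by minimality it is `g`. -/
theorem IsConvex.exists_isGate (hG : IsMedianGraph G) {S : Set V} (hS : IsConvex G S)
    (hne : S.Nonempty) (x : V) : ∃ g, IsGate G S x g := by
  classical
  obtain ⟨g, hg, hmin⟩ := WellFounded.has_min (measure fun y => G.dist x y).wf S hne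
  refine ⟨g, hg, fun y hy => ?_⟩
  obtain ⟨m, ⟨⟨hm1, hm2⟩, hm3⟩, -⟩ := hG.existsUnique_median x g y
  have hmS : m ∈ S := hS g hg y hy hm2
  have := hmin m hmS
  have hlt : ¬ G.dist x m < G.dist x g := this
  rw [mem_interval] at hm1
  have : m = g := hG.connected.dist_eq_zero_iff.1 (by omega)
  rw [interval_comm]
  exact this ▸ hm3

/-- Each next vertex of a shortest path lies in the interval of its ends, hence in `S`. This makes
convex subgraphs isometric, which keeps distances and gates meaningful in the recursion. -/
theorem IsConvex.dist_induce (hG : G.Connected) {S : Set V} (hS : IsConvex G S) (x y : S) :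
    ∃ p : (G.induce S).Walk x y, p.length = G.dist (x : V) y := by
  induction hk : G.dist (x : V) y generalizing x with
  | zero =>
    obtain rfl : x = y := Subtype.ext (hG.dist_eq_zero_iff.1 hk)
    exact ⟨.nil, rfl⟩
  | succ k ih =>
    have hne : (x : V) ≠ y := fun h => by rw [h, G.dist_self] at hk; omega
    obtain ⟨z, hxz, hz⟩ := exists_adj_dist_eq hG hne
    have hzS : z ∈ S := hS x x.2 y y.2 (by
      rw [mem_interval, SimpleGraph.dist_eq_one_iff_adj.2 hxz]; omega)
    obtain ⟨p, hp⟩ := ih ⟨z, hzS⟩ (by change G.dist z y = k; omega)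
    exact ⟨SimpleGraph.Walk.cons (v := ⟨z, hzS⟩) (SimpleGraph.induce_adj.2 hxz) p, by rw [SimpleGraph.Walk.length_cons, hp]⟩

theorem IsConvex.induce_connected (hG : G.Connected) {S : Set V} (hS : IsConvex G S)
    (hne : S.Nonempty) : (G.induce S).Connected :=
  (SimpleGraph.connected_iff _).2
    ⟨fun x y => (hS.dist_induce hG x y).choose.reachable, hne.to_subtype⟩

theorem IsConvex.induce_dist_eq (hG : G.Connected) {S : Set V} (hS : IsConvex G S) (x y : S) :
    (G.induce S).dist x y = G.dist (x : V) y := by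
  obtain ⟨p, hp⟩ := hS.dist_induce hG x y
  apply le_antisymm (hp ▸ SimpleGraph.dist_le p)
  obtain ⟨q, hq⟩ := p.reachable.exists_walk_length_eq_dist
  rw [← hq, ← SimpleGraph.Walk.length_map (SimpleGraph.Embedding.induce S).toHom q]
  exact SimpleGraph.dist_le _

theorem IsConvex.induce_isMedianGraph (hG : IsMedianGraph G) {S : Set V} (hS : IsConvex G S)
    (hne : S.Nonempty) : IsMedianGraph (G.induce S) := by
  refine ⟨hS.induce_connected hG.connected hne, fun x y z => ?_⟩
  have key : ∀ m : S, IsMedianOf (G.induce S) x y z m ↔ IsMedianOf G (x : V) y z m := fun m => by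
    simp only [IsMedianOf, Set.mem_inter_iff, mem_interval, hS.induce_dist_eq hG.connected]
  obtain ⟨m, hm, huniq⟩ := hG.existsUnique_median x y z
  exact ⟨⟨m, hS x x.2 y y.2 hm.1.1⟩, (key _).2 hm,
    fun m' hm' => Subtype.ext (huniq m' ((key m').1 hm'))⟩

/-! ### Halfspaces -/

/-- The vertices that are closer to `a` than to `b`. -/
def nearer (G : SimpleGraph V) (a b : V) : Set V := {x | G.dist x a < G.dist x b}

theorem mem_nearer {a b x : V} : x ∈ nearer G a b ↔ G.dist x a < G.dist x b := Iff.rfl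

theorem dist_le_dist_add_one (hG : G.Connected) {a b : V} (hab : G.Adj a b) (x : V) :
    G.dist x a ≤ G.dist x b + 1 := by
  have := hG.dist_triangle (u := x) (v := b) (w := a)
  rwa [SimpleGraph.dist_eq_one_iff_adj.2 hab.symm] at this

/-- Bipartiteness: a median of `a, b, x` must be `a` or `b`, since `ab` is an edge, and then the
distances to `x` differ. -/
theorem IsMedianGraph.dist_eq_or (hG : IsMedianGraph G) {a b : V} (hab : G.Adj a b) (x : V) :
    G.dist x b = G.dist x a + 1 ∨ G.dist x a = G.dist x b + 1 := by
  have h1 := dist_le_dist_add_one hG.connected hab x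
  have h2 := dist_le_dist_add_one hG.connected hab.symm x
  suffices G.dist x a ≠ G.dist x b by omega
  intro h
  obtain ⟨m, ⟨⟨hm1, hm2⟩, hm3⟩, -⟩ := hG.existsUnique_median a b x
  rw [mem_interval] at hm1 hm2 hm3
  rw [SimpleGraph.dist_eq_one_iff_adj.2 hab] at hm1
  rw [G.dist_comm (u := b), G.dist_comm (u := b) (v := x), G.dist_comm (u := m) (v := x)] at hm2
  rw [G.dist_comm (u := m) (v := a)] at hm3
  omega

theorem IsMedianGraph.mem_nearer_iff (hG : IsMedianGraph G) {a b : V} (hab : G.Adj a b) {x : V} :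
    x ∈ nearer G a b ↔ G.dist x b = G.dist x a + 1 := by
  have := hG.dist_eq_or hab x
  rw [mem_nearer]
  omega

theorem IsMedianGraph.not_mem_nearer_iff (hG : IsMedianGraph G) {a b : V} (hab : G.Adj a b)
    {x : V} : x ∉ nearer G a b ↔ G.dist x a = G.dist x b + 1 := by
  have := hG.dist_eq_or hab x
  rw [mem_nearer]
  omega

theorem IsMedianGraph.nearer_compl (hG : IsMedianGraph G) {a b : V} (hab : G.Adj a b) :
    (nearer G a b)ᶜ = nearer G b a := by
  ext x
  rw [Set.mem_compl_iff, hG.not_mem_nearer_iff hab, hG.mem_nearer_iff hab.symm]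

theorem left_mem_nearer {a b : V} (hab : G.Adj a b) : a ∈ nearer G a b := by
  simp [mem_nearer, SimpleGraph.dist_eq_one_iff_adj.2 hab]

theorem right_not_mem_nearer {a b : V} : b ∉ nearer G a b := by
  simp [mem_nearer]

/-- The two sides of an edge of a square do not change when passing to the opposite edge. -/
theorem IsMedianGraph.nearer_subset_of_square (hG : IsMedianGraph G) {a b c d : V}
    (hab : G.Adj a b) (hcd : G.Adj c d) (hac : G.Adj a c) (hbd : G.Adj b d) (had : a ≠ d)
    (hbc : b ≠ c) : nearer G a b ⊆ nearer G c d := by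
  intro x hx
  by_contra hx'
  rw [hG.mem_nearer_iff hab] at hx
  rw [hG.not_mem_nearer_iff hcd] at hx'
  have h1 := hG.dist_eq_or hac x
  have h2 := hG.dist_eq_or hbd x
  have h3 := hG.dist_eq_or hab c
  have h4 := hG.dist_eq_or hbd c
  have e1 := SimpleGraph.dist_eq_one_iff_adj.2 hab
  have e2 := SimpleGraph.dist_eq_one_iff_adj.2 hcd
  have e3 := SimpleGraph.dist_eq_one_iff_adj.2 hac
  have e4 := SimpleGraph.dist_eq_one_iff_adj.2 hbd
  have h5 := hG.connected.pos_dist_of_ne hbc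
  have c1 := G.dist_comm (u := a) (v := b)
  have c2 := G.dist_comm (u := c) (v := d)
  have c3 := G.dist_comm (u := a) (v := c)
  have c4 := G.dist_comm (u := b) (v := d)
  have c5 := G.dist_comm (u := b) (v := c)
  have x1 := G.dist_comm (u := x) (v := a)
  have x2 := G.dist_comm (u := x) (v := b)
  have x3 := G.dist_comm (u := x) (v := c)
  have x4 := G.dist_comm (u := x) (v := d)
  -- If `x` changed sides, the distances would force both `a` and `d` to be medians of `b, c, x`.
  refine had ((hG.existsUnique_median b c x).unique (y₁ := a) (y₂ := d) ?_ ?_) <;>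
  · simp only [IsMedianOf, Set.mem_inter_iff, mem_interval]
    omega

theorem IsMedianGraph.nearer_eq_of_square (hG : IsMedianGraph G) {a b c d : V}
    (hab : G.Adj a b) (hcd : G.Adj c d) (hac : G.Adj a c) (hbd : G.Adj b d) (had : a ≠ d)
    (hbc : b ≠ c) : nearer G a b = nearer G c d :=
  (hG.nearer_subset_of_square hab hcd hac hbd had hbc).antisymm
    (hG.nearer_subset_of_square hcd hab hac.symm hbd.symm hbc.symm had.symm)

/-- The class of an edge. -/
def thetaOf {a b : V} (hab : G.Adj a b) : ThetaClass G :=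
  Quot.mk (SquareOpposite G) ⟨s(a, b), hab⟩

theorem mem_edges_iff {E : ThetaClass G} {a b : V} :
    s(a, b) ∈ E.edges ↔ ∃ hab : G.Adj a b, thetaOf hab = E := Iff.rfl

theorem exists_thetaOf_eq (E : ThetaClass G) : ∃ (a b : V) (hab : G.Adj a b), thetaOf hab = E := by
  induction E using Quot.ind with
  | mk e =>
    obtain ⟨e, he⟩ := e
    induction e using Sym2.ind with
    | h a b => exact ⟨a, b, he, rfl⟩

theorem thetaOf_symm {a b : V} (hab : G.Adj a b) : thetaOf hab.symm = thetaOf hab := by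
  unfold thetaOf
  congr 2
  exact Sym2.eq_swap

/-- An edge that crosses between the sides of `ab` belongs to the class of `ab`. -/
theorem IsMedianGraph.thetaOf_eq_of_mem (hG : IsMedianGraph G) {a b c d : V} (hab : G.Adj a b)
    (hcd : G.Adj c d) (hc : c ∈ nearer G a b) (hd : d ∉ nearer G a b) :
    thetaOf hcd = thetaOf hab := by
  induction hk : G.dist d b generalizing c d with
  | zero =>
    obtain rfl : d = b := hG.connected.dist_eq_zero_iff.1 hk
    rw [hG.mem_nearer_iff hab] at hc
    rw [SimpleGraph.dist_eq_one_iff_adj.2 hcd] at hc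
    obtain rfl : c = a := hG.connected.dist_eq_zero_iff.1 (by omega)
    rfl
  | succ k ih =>
    rw [hG.mem_nearer_iff hab] at hc
    rw [hG.not_mem_nearer_iff hab] at hd
    have hne : d ≠ b := fun h => by rw [h, G.dist_self] at hk; omega
    obtain ⟨d', hdd', hd'⟩ := exists_adj_dist_eq hG.connected hne
    have e1 := dist_le_dist_add_one hG.connected hab d'
    have e2 := dist_le_dist_add_one hG.connected hdd' a
    have e3 := dist_le_dist_add_one hG.connected hcd a
    have e4 := dist_le_dist_add_one hG.connected hcd b
    have e5 := dist_le_dist_add_one hG.connected hcd.symm a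
    have e6 := dist_le_dist_add_one hG.connected hcd.symm b
    simp only [fun y => G.dist_comm (u := a) (v := y), fun y => G.dist_comm (u := b) (v := y)]
      at e2 e3 e4 e5 e6
    have hcd' : c ≠ d' := fun h => by subst h; omega
    have h2 : G.dist c d' = 2 := by
      have t1 := hG.dist_eq_or hdd' c
      have t2 := hG.connected.pos_dist_of_ne hcd'
      rw [SimpleGraph.dist_eq_one_iff_adj.2 hcd] at t1
      omega
    -- The median of `c, d', a` completes `c, d, d'` to a square. Its edge `c'd'` is opposite to
    -- `cd`, still crosses, and is one step closer to `b`.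
    obtain ⟨c', ⟨⟨hm1, hm2⟩, hm3⟩, -⟩ := hG.existsUnique_median c d' a
    rw [mem_interval] at hm1 hm2 hm3
    simp only [fun y => G.dist_comm (u := a) (v := y)] at hm3
    rw [G.dist_comm (u := d') (v := c')] at hm2
    rw [G.dist_comm (u := c') (v := c)] at hm3
    have hcc' : G.Adj c c' := SimpleGraph.dist_eq_one_iff_adj.1 (by omega)
    have hc'd' : G.Adj c' d' := SimpleGraph.dist_eq_one_iff_adj.1 (by omega)
    have f1 := dist_le_dist_add_one hG.connected hc'd' b
    have f2 := dist_le_dist_add_one hG.connected hcc' b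
    simp only [fun y => G.dist_comm (u := b) (v := y)] at f1 f2
    have := ih hc'd' ((hG.mem_nearer_iff hab).2 (by omega))
      ((hG.not_mem_nearer_iff hab).2 (by omega)) (by omega)
    rw [← this]
    refine Quot.sound ⟨c, d, c', d', rfl, rfl, hcc', hdd', hcd', ?_⟩
    rintro rfl
    omega

/-- The unordered pair of sides of an edge is unchanged by passing to an opposite edge of a square,
hence by the generated equivalence. The property `P` quantifies over all representations of the
edges as pairs, which absorbs orientations. -/
theorem IsMedianGraph.sides_eq_of_thetaOf_eq (hG : IsMedianGraph G) {a b c d : V}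
    (hab : G.Adj a b) (hcd : G.Adj c d) (h : thetaOf hab = thetaOf hcd) :
    nearer G a b = nearer G c d ∨ nearer G a b = nearer G d c := by
  let P : G.edgeSet → G.edgeSet → Prop := fun e f => ∀ a b c d : V, e.1 = s(a, b) → f.1 = s(c, d) →
    nearer G a b = nearer G c d ∨ nearer G a b = nearer G d c
  suffices hP : ∀ e f, Relation.EqvGen (SquareOpposite G) e f → P e f from
    hP _ _ (Quot.eqvGen_exact h) a b c d rfl rfl
  intro e f hef
  induction hef with
  | rel e f hef =>
    obtain ⟨a, b, c, d, he, hf, hac, hbd, had, hbc⟩ := hef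
    intro a' b' c' d' he' hf'
    have hab : G.Adj a b := by have := e.2; rwa [he] at this
    have hcd : G.Adj c d := by have := f.2; rwa [hf] at this
    have h1 := hG.nearer_eq_of_square hab hcd hac hbd had hbc
    have h2 := hG.nearer_eq_of_square hab.symm hcd.symm hbd hac hbc had
    rw [he, Sym2.eq_iff] at he'
    rw [hf, Sym2.eq_iff] at hf'
    obtain ⟨rfl, rfl⟩ | ⟨rfl, rfl⟩ := he' <;> obtain ⟨rfl, rfl⟩ | ⟨rfl, rfl⟩ := hf' <;> simp [h1, h2]
  | refl e =>
    intro a b c d he hf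
    rw [he, Sym2.eq_iff] at hf
    obtain ⟨rfl, rfl⟩ | ⟨rfl, rfl⟩ := hf <;> simp
  | symm e f _ ih =>
    intro a b c d he hf
    have hcd : G.Adj c d := by have := e.2; rwa [hf] at this
    have hab : G.Adj a b := by have := f.2; rwa [he] at this
    obtain h | h := ih c d a b hf he
    · exact .inl h.symm
    · right
      rw [← hG.nearer_compl hab.symm, ← hG.nearer_compl hcd, h]
  | trans e f g _ _ ih1 ih2 =>
    intro a b c d he hg
    obtain ⟨f, hf⟩ := f
    induction f using Sym2.ind with
    | h x y =>
      obtain h1 | h1 := ih1 a b x y he rfl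
      · exact h1 ▸ ih2 x y c d rfl hg
      · exact h1 ▸ ih2 y x c d Sym2.eq_swap hg

/-- The two previous lemmas combined: a class generated by squares is a full cut, the one between
the sides of any of its edges. -/
theorem IsMedianGraph.mem_edges_iff_crossing (hG : IsMedianGraph G) {a b c d : V}
    (hab : G.Adj a b) (hcd : G.Adj c d) :
    s(c, d) ∈ (thetaOf hab).edges ↔ ¬ (c ∈ nearer G a b ↔ d ∈ nearer G a b) := by
  rw [mem_edges_iff]
  constructor
  · rintro ⟨_, h⟩
    have h1 := left_mem_nearer hcd
    have h2 := right_not_mem_nearer (G := G) (a := c) (b := d)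
    have h3 := left_mem_nearer hcd.symm
    have h4 := right_not_mem_nearer (G := G) (a := d) (b := c)
    obtain h | h := hG.sides_eq_of_thetaOf_eq hab hcd h.symm <;> rw [h] <;> tauto
  · intro h
    refine ⟨hcd, ?_⟩
    by_cases hc : c ∈ nearer G a b
    · exact hG.thetaOf_eq_of_mem hab hcd hc (by tauto)
    · rw [← thetaOf_symm]
      exact hG.thetaOf_eq_of_mem hab hcd.symm (by tauto) hc

/-- A shortest path from `x` to `a` stays on the side of `a`, so it uses no edge of the class. -/
theorem IsMedianGraph.reachable_cut_of_mem (hG : IsMedianGraph G) {a b x : V} (hab : G.Adj a b)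
    (hx : x ∈ nearer G a b) : (thetaOf hab).cut.Reachable x a := by
  induction hk : G.dist x a generalizing x with
  | zero => rw [hG.connected.dist_eq_zero_iff.1 hk]
  | succ k ih =>
    have hne : x ≠ a := fun h => by rw [h, G.dist_self] at hk; omega
    obtain ⟨z, hxz, hz⟩ := exists_adj_dist_eq hG.connected hne
    have h1 := dist_le_dist_add_one hG.connected hxz b
    simp only [fun y => G.dist_comm (u := b) (v := y)] at h1
    have hzm : z ∈ nearer G a b := by
      rw [hG.mem_nearer_iff hab] at hx
      rw [mem_nearer]
      omega
    refine SimpleGraph.Reachable.trans (SimpleGraph.Adj.reachable ?_) (ih hzm (by omega))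
    refine SimpleGraph.deleteEdges_adj.2 ⟨hxz, fun h => ?_⟩
    exact (hG.mem_edges_iff_crossing hab hxz).1 h (by tauto)

theorem IsMedianGraph.mem_iff_of_reachable_cut (hG : IsMedianGraph G) {a b x y : V}
    (hab : G.Adj a b) (h : (thetaOf hab).cut.Reachable x y) :
    x ∈ nearer G a b ↔ y ∈ nearer G a b := by
  obtain ⟨p⟩ := h
  induction p with
  | nil => rfl
  | cons hxz _ ih =>
    rw [← ih]
    by_contra hcon
    obtain ⟨h1, h2⟩ := SimpleGraph.deleteEdges_adj.1 hxz
    exact h2 ((hG.mem_edges_iff_crossing hab h1).2 hcon)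

theorem IsMedianGraph.reachable_cut_iff (hG : IsMedianGraph G) {a b x y : V} (hab : G.Adj a b) :
    (thetaOf hab).cut.Reachable x y ↔ (x ∈ nearer G a b ↔ y ∈ nearer G a b) := by
  refine ⟨hG.mem_iff_of_reachable_cut hab, fun h => ?_⟩
  have key : ∀ z, z ∉ nearer G a b → (thetaOf hab).cut.Reachable z b := fun z hz => by
    rw [← Set.mem_compl_iff, hG.nearer_compl hab] at hz
    exact thetaOf_symm hab ▸ hG.reachable_cut_of_mem hab.symm hz
  by_cases hx : x ∈ nearer G a b
  · exact (hG.reachable_cut_of_mem hab hx).trans (hG.reachable_cut_of_mem hab (h.1 hx)).symm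
  · exact (key x hx).trans (key y fun hy => hx (h.2 hy)).symm

theorem IsMedianGraph.isHalfspace_iff (hG : IsMedianGraph G) {a b : V} (hab : G.Adj a b)
    {H : Set V} :
    (thetaOf hab).IsHalfspace H ↔ H = nearer G a b ∨ H = nearer G b a := by
  have key : ∀ x, ((thetaOf hab).cut.connectedComponentMk x).supp =
      {y | y ∈ nearer G a b ↔ x ∈ nearer G a b} := fun x => by
    ext y
    rw [SimpleGraph.ConnectedComponent.mem_supp_iff, SimpleGraph.ConnectedComponent.eq,
      hG.reachable_cut_iff, Set.mem_ofPred_eq]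
  have ha : ((thetaOf hab).cut.connectedComponentMk a).supp = nearer G a b := by
    rw [key]; ext y; simp [left_mem_nearer hab]
  have hb : ((thetaOf hab).cut.connectedComponentMk b).supp = nearer G b a := by
    rw [key, ← hG.nearer_compl hab]; ext y; simp [right_not_mem_nearer]
  constructor
  · rintro ⟨c, rfl⟩
    induction c using SimpleGraph.ConnectedComponent.ind with
    | h x =>
      by_cases hx : x ∈ nearer G a b
      · left; rw [key]; ext y; simp [hx]
      · right; rw [key, ← hG.nearer_compl hab]; ext y; simp [hx]
  · rintro (rfl | rfl)
    · exact ⟨_, ha.symm⟩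
    · exact ⟨_, hb.symm⟩

/-- The edge `cd` is the first one by which a shortest path from `x` to `y` leaves `S`. -/
theorem exists_crossing (hG : G.Connected) {S : Set V} {x y : V} (hx : x ∈ S) (hy : y ∉ S) :
    ∃ c d, G.Adj c d ∧ c ∈ S ∧ d ∉ S ∧ G.dist x c + 1 + G.dist d y = G.dist x y := by
  induction hk : G.dist x y generalizing x with
  | zero => exact absurd (hG.dist_eq_zero_iff.1 hk ▸ hx) hy
  | succ k ih =>
    have hne : x ≠ y := fun h => hy (h ▸ hx)
    obtain ⟨z, hxz, hz⟩ := exists_adj_dist_eq hG hne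
    by_cases hzS : z ∈ S
    · obtain ⟨c, d, hcd, hc, hd, h⟩ := ih hzS (by omega)
      refine ⟨c, d, hcd, hc, hd, ?_⟩
      have h1 := hG.dist_triangle (u := x) (v := z) (w := c)
      have h2 := hG.dist_triangle (u := x) (v := c) (w := y)
      have h3 := hG.dist_triangle (u := c) (v := d) (w := y)
      rw [SimpleGraph.dist_eq_one_iff_adj.2 hxz] at h1
      rw [SimpleGraph.dist_eq_one_iff_adj.2 hcd] at h3
      omega
    · exact ⟨x, z, hxz, hx, hzS, by rw [G.dist_self]; omega⟩

/-- A shortest path from `x` to `y` through a vertex `z` of the other side leaves through an edge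
`cd` of the same class, so `y` is nearer to `c` than to `d`. But the path reaches `y` after passing
from `c` to `d`, a contradiction. -/
theorem IsMedianGraph.isConvex_nearer (hG : IsMedianGraph G) {a b : V} (hab : G.Adj a b) :
    IsConvex G (nearer G a b) := by
  intro x hx y hy z hz
  by_contra hzn
  obtain ⟨c, d, hcd, hc, hd, h⟩ := exists_crossing hG.connected hx hzn
  have hy' : y ∈ nearer G c d := by
    obtain h | h := hG.sides_eq_of_thetaOf_eq hab hcd (hG.thetaOf_eq_of_mem hab hcd hc hd).symm
    · exact h ▸ hy
    · exact absurd (h ▸ hc) right_not_mem_nearer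
  rw [mem_nearer] at hy'
  rw [mem_interval] at hz
  rw [G.dist_comm (u := y) (v := c), G.dist_comm (u := y) (v := d)] at hy'
  have h1 := hG.connected.dist_triangle (u := x) (v := c) (w := y)
  have h2 := hG.connected.dist_triangle (u := d) (v := z) (w := y)
  omega

theorem IsMedianGraph.isConvex_not_nearer (hG : IsMedianGraph G) {a b : V} (hab : G.Adj a b) :
    IsConvex G (nearer G a b)ᶜ := hG.nearer_compl hab ▸ hG.isConvex_nearer hab.symm

theorem IsMedianGraph.mem_signature_iff (hG : IsMedianGraph G) {a b x y : V} (hab : G.Adj a b) :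
    thetaOf hab ∈ signature G x y ↔ ¬ (x ∈ nearer G a b ↔ y ∈ nearer G a b) := by
  rw [signature, Set.mem_ofPred_eq, hG.reachable_cut_iff]

end MedianGraphs

section Ladders

variable {V : Type u} {G : SimpleGraph V} {v₀ : V}

/-! ### Ladder sets and their fibers -/

/-- The dictionary between ladder sets and halfspaces on which all later arguments about ladder sets
rest. -/
theorem IsMedianGraph.thetaOf_mem_ladder_iff (hG : IsMedianGraph G) {x u : V} (hx : G.Adj v₀ x) :
    thetaOf hx ∈ ladder G v₀ u ↔ u ∉ nearer G v₀ x := by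
  rw [ladder, Set.mem_ofPred_eq, hG.mem_signature_iff hx]
  have h1 := left_mem_nearer hx
  have h2 : ∃ y, s(v₀, y) ∈ (thetaOf hx).edges := ⟨x, hx, rfl⟩
  tauto

theorem exists_adj_of_mem_ladder {E : ThetaClass G} {u : V} (hE : E ∈ ladder G v₀ u) :
    ∃ (x : V) (hx : G.Adj v₀ x), thetaOf hx = E :=
  let ⟨_, x, h⟩ := hE
  ⟨x, mem_edges_iff.1 h⟩

theorem IsMedianGraph.ladder_subset_ladder (hG : IsMedianGraph G) {x u : V}
    (h : ∀ y, G.Adj v₀ y → u ∈ nearer G v₀ y → x ∈ nearer G v₀ y) :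
    ladder G v₀ x ⊆ ladder G v₀ u := by
  intro E hE
  obtain ⟨y, hy, rfl⟩ := exists_adj_of_mem_ladder hE
  rw [hG.thetaOf_mem_ladder_iff] at hE ⊢
  exact fun hu => hE (h y hy hu)

theorem ladder_self : ladder G v₀ v₀ = ∅ := by
  ext E
  simp [ladder, signature]

/-- Otherwise the first edge of a shortest path from `v₀` to `x` has its class in the ladder set. -/
theorem IsMedianGraph.eq_of_ladder_eq_empty (hG : IsMedianGraph G) {x : V}
    (h : ladder G v₀ x = ∅) : x = v₀ := by
  by_contra hne
  obtain ⟨y, hy, hd⟩ := exists_adj_dist_eq hG.connected (Ne.symm hne)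
  have : thetaOf hy ∈ ladder G v₀ x := by
    rw [hG.thetaOf_mem_ladder_iff, hG.not_mem_nearer_iff hy, G.dist_comm, hd, G.dist_comm]
  simp [h] at this

/-- The ladder set records on which side of each cut at `v₀` a vertex lies, so a nonempty fiber is
an intersection of halfspaces. -/
theorem IsMedianGraph.isConvex_ladderFiber (hG : IsMedianGraph G) (L : Set (ThetaClass G)) :
    IsConvex G (ladderFiber G v₀ L) := by
  intro x hx y hy z hz
  have hx' : ladder G v₀ x = L := hx
  have hy' : ladder G v₀ y = L := hy
  have hxy : ∀ a, G.Adj v₀ a → (x ∈ nearer G v₀ a ↔ y ∈ nearer G v₀ a) := fun a ha => by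
    rw [← not_iff_not, ← hG.thetaOf_mem_ladder_iff ha, ← hG.thetaOf_mem_ladder_iff ha, hx', hy']
  refine Eq.trans ?_ hx'
  refine (hG.ladder_subset_ladder fun a ha h => ?_).antisymm
    (hG.ladder_subset_ladder fun a ha h => ?_)
  · exact hG.isConvex_nearer ha x h y ((hxy a ha).1 h) hz
  · by_contra hn
    exact hG.isConvex_not_nearer ha x hn y (fun h' => hn ((hxy a ha).2 h')) hz h

/-- The gate of `u` in the halfspace of `v₀` bounded by a class `E` of the ladder set of `u` has
the ladder set of `u` deprived of `E`. -/
theorem IsMedianGraph.ladder_gate (hG : IsMedianGraph G) {x u g : V} (hx : G.Adj v₀ x)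
    (hg : IsGate G (nearer G v₀ x) u g) :
    ladder G v₀ g = ladder G v₀ u \ {thetaOf hx} := by
  have hv₀ := left_mem_nearer hx
  apply Set.Subset.antisymm
  · refine Set.subset_sdiff_singleton (hG.ladder_subset_ladder fun y hy hu => ?_) ?_
    · exact hG.isConvex_nearer hy u hu v₀ (left_mem_nearer hy) (hg.2 v₀ hv₀)
    · rw [hG.thetaOf_mem_ladder_iff, not_not]
      exact hg.1
  · rintro F ⟨hF, hne⟩
    obtain ⟨y, hy, rfl⟩ := exists_adj_of_mem_ladder hF
    rw [hG.thetaOf_mem_ladder_iff] at hF ⊢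
    -- The edge `v₀y` belongs to a class other than that of `v₀x`, so it does not cross that cut.
    -- Thus `y` is in the halfspace of the gate, and the gate lies between `u` and `y`, which are
    -- both across the cut of `v₀y`.
    have hyx : y ∈ nearer G v₀ x := by
      by_contra h
      exact hne (hG.thetaOf_eq_of_mem hx hy hv₀ h)
    exact hG.isConvex_not_nearer hy u hF y right_not_mem_nearer (hg.2 y hyx)

/-- The gate in the halfspace of `v₀` lands in the fiber of `L_u \ {E}`, which is contained in that
halfspace, so it is also the gate in the fiber. It keeps the interval property for the whole
halfspace. -/
theorem IsMedianGraph.exists_ladder_gate (hG : IsMedianGraph G) {u : V} {E : ThetaClass G}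
    (hE : E ∈ ladder G v₀ u) :
    ∃ g, IsGate G (ladderFiber G v₀ (ladder G v₀ u \ {E})) u g ∧
      ∀ y, E ∉ ladder G v₀ y → g ∈ interval G u y := by
  obtain ⟨x, hx, rfl⟩ := exists_adj_of_mem_ladder hE
  obtain ⟨g, hg⟩ := (hG.isConvex_nearer hx).exists_isGate hG ⟨v₀, left_mem_nearer hx⟩ u
  have key : ∀ y, thetaOf hx ∉ ladder G v₀ y → g ∈ interval G u y := fun y hy => by
    rw [hG.thetaOf_mem_ladder_iff, not_not] at hy
    exact hg.2 y hy
  refine ⟨g, ⟨hG.ladder_gate hx hg, fun y hy => key y ?_⟩, key⟩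
  rw [show ladder G v₀ y = _ from hy]
  simp

/-- By uniqueness of gates, a gate known only with respect to the fiber, as in the labels, has the
stronger property for all vertices on the side of `v₀`. -/
theorem IsMedianGraph.gate_mem_interval (hG : IsMedianGraph G) {u g y : V} {E : ThetaClass G}
    (hE : E ∈ ladder G v₀ u) (hg : IsGate G (ladderFiber G v₀ (ladder G v₀ u \ {E})) u g)
    (hy : E ∉ ladder G v₀ y) : g ∈ interval G u y := by
  obtain ⟨g', hg', h⟩ := hG.exists_ladder_gate hE
  rw [hg.unique hG.connected hg']
  exact h y hy

/-- For each cut at `v₀`, convexity of both sides puts the median on the side containing a majority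
of `u, v, v₀`. -/
theorem IsMedianGraph.ladder_median (hG : IsMedianGraph G) {u v m : V}
    (hm : IsMedianOf G u v v₀ m) : ladder G v₀ m = ladder G v₀ u ∩ ladder G v₀ v := by
  obtain ⟨⟨h1, h2⟩, h3⟩ := hm
  apply Set.Subset.antisymm
  · refine Set.subset_inter (hG.ladder_subset_ladder fun y hy hu => ?_)
      (hG.ladder_subset_ladder fun y hy hu => ?_)
    · exact hG.isConvex_nearer hy _ (left_mem_nearer hy) _ hu h3
    · exact hG.isConvex_nearer hy _ hu _ (left_mem_nearer hy) h2
  · rintro E ⟨hu, hv⟩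
    obtain ⟨y, hy, rfl⟩ := exists_adj_of_mem_ladder hu
    rw [hG.thetaOf_mem_ladder_iff] at hu hv ⊢
    exact hG.isConvex_not_nearer hy _ hu _ hv h1

/-! ### Counting -/

section Finite

variable [Finite V]

instance : Finite (ThetaClass G) := inferInstanceAs (Finite (Quot (SquareOpposite G)))

/-- Unwanted classes are withdrawn one by one, each time by passing to a gate. -/
theorem IsMedianGraph.exists_ladder_eq (hG : IsMedianGraph G) (u : V) {S : Set (ThetaClass G)}
    (hS : S ⊆ ladder G v₀ u) : ∃ x, ladder G v₀ x = S := by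
  suffices h : ∀ T : Set (ThetaClass G), T ⊆ ladder G v₀ u → ∃ x, ladder G v₀ x = ladder G v₀ u \ T by
    obtain ⟨x, hx⟩ := h (ladder G v₀ u \ S) Set.sdiff_subset
    exact ⟨x, by rw [hx, Set.sdiff_sdiff_cancel_left hS]⟩
  intro T
  induction T, T.toFinite using Set.Finite.induction_on with
  | empty => exact fun _ => ⟨u, by simp⟩
  | @insert E T hE _ ih =>
    intro hT
    obtain ⟨x, hx⟩ := ih ((Set.subset_insert _ _).trans hT)
    obtain ⟨g, hg, -⟩ := hG.exists_ladder_gate (v₀ := v₀) (u := x) (E := E)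
      (by rw [hx]; exact ⟨hT (Set.mem_insert _ _), hE⟩)
    refine ⟨g, ?_⟩
    rw [show ladder G v₀ g = _ from hg.1, hx, Set.sdiff_sdiff, Set.union_singleton]

/-- Distinct subsets of the ladder set are ladder sets of distinct vertices. Hence a ladder set has
at most `w` classes, which bounds both the blocks of the labels and the loops of the query. -/
theorem IsMedianGraph.two_pow_ncard_ladder_le (hG : IsMedianGraph G) (u : V) :
    2 ^ (ladder G v₀ u).ncard ≤ Nat.card V := by
  rw [← Set.ncard_powerset _, ← Set.ncard_univ]
  have : (ladder G v₀ u).powerset ⊆ ladder G v₀ '' Set.univ := fun S hS => by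
    obtain ⟨x, hx⟩ := hG.exists_ladder_eq u hS
    exact ⟨x, trivial, hx⟩
  exact (Set.ncard_le_ncard this (Set.toFinite _)).trans (Set.ncard_image_le (Set.toFinite _))

/-- Each vertex other than `v` is assigned the class of the first edge of a shortest path to `v`.
Every class arises: take the vertex nearest to `v` on the other side of its cut. So class indices
fit into `w` bits. -/
theorem IsMedianGraph.card_thetaClass_lt (hG : IsMedianGraph G) :
    Nat.card (ThetaClass G) < Nat.card V := by
  obtain ⟨v⟩ := hG.connected.nonempty
  choose p hp hd using fun x : {x // x ≠ v} => exists_adj_dist_eq hG.connected x.2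
  have hsurj : Function.Surjective fun x => thetaOf (hp x) := fun E => by
    obtain ⟨a, b, hab, rfl⟩ := exists_thetaOf_eq E
    wlog hv : v ∈ nearer G a b generalizing a b
    · have := this b a hab.symm (by rwa [← hG.nearer_compl hab])
      rwa [thetaOf_symm] at this
    obtain ⟨x, hx, hmin⟩ := WellFounded.has_min (measure fun y => G.dist y v).wf (nearer G a b)ᶜ
      ⟨b, right_not_mem_nearer⟩
    have hne : x ≠ v := fun h => hx (h ▸ hv)
    refine ⟨⟨x, hne⟩, ?_⟩
    have hpx : p ⟨x, hne⟩ ∈ nearer G a b := by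
      by_contra h
      have hlt : ¬ G.dist (p ⟨x, hne⟩) v < G.dist x v := hmin _ h
      have := hd ⟨x, hne⟩
      dsimp only at this
      omega
    have := hG.thetaOf_eq_of_mem hab (hp ⟨x, hne⟩).symm hpx hx
    rwa [thetaOf_symm] at this
  exact (Nat.card_le_card_of_surjective _ hsurj).trans_lt
    (Finite.card_subtype_lt (x := v) (by simp))

/-- Moving from `v₀` to its neighbor `x` adds one to the distances to the vertices nearer to `v₀`
and subtracts one from all others. By minimality at `v₀`, the latter are at most half of all
vertices. -/
theorem IsMedianGraph.two_mul_ncard_compl_nearer_le (hG : IsMedianGraph G)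
    (hv₀ : IsMedianVertex G v₀) {x : V} (hx : G.Adj v₀ x) :
    2 * (nearer G v₀ x)ᶜ.ncard ≤ Nat.card V := by
  classical
  have := Fintype.ofFinite V
  have h := hv₀ x
  rw [finsum_eq_sum_of_fintype, finsum_eq_sum_of_fintype] at h
  have key : ∀ y, G.dist x y + (if y ∈ (nearer G v₀ x)ᶜ then 1 else 0) =
      G.dist v₀ y + (if y ∈ nearer G v₀ x then 1 else 0) := fun y => by
    rw [G.dist_comm (u := x), G.dist_comm (u := v₀)]
    by_cases hy : y ∈ nearer G v₀ x
    · have := (hG.mem_nearer_iff hx).1 hy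
      simp [hy, this]
    · have := (hG.not_mem_nearer_iff hx).1 hy
      simp [hy, this]
  have hsum := Finset.sum_congr (rfl : (Finset.univ : Finset V) = Finset.univ) fun y _ => key y
  rw [Finset.sum_add_distrib, Finset.sum_add_distrib, Finset.sum_boole, Finset.sum_boole] at hsum
  have e1 : ∀ (S : Set V) [DecidablePred (· ∈ S)], (Finset.univ.filter fun y => y ∈ S).card = S.ncard := fun S _ => by
    rw [← Set.ncard_coe_finset]
    simp
  rw [e1, e1] at hsum
  have := Set.ncard_add_ncard_compl (nearer G v₀ x)
  simp only [Nat.cast_id] at hsum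
  omega

theorem IsMedianGraph.two_mul_ncard_ladderFiber_le (hG : IsMedianGraph G)
    (hv₀ : IsMedianVertex G v₀) {L : Set (ThetaClass G)} (hL : L.Nonempty) :
    2 * Nat.card (ladderFiber G v₀ L) ≤ Nat.card V := by
  rcases (ladderFiber G v₀ L).eq_empty_or_nonempty with h | ⟨u, hu⟩
  · simp [h]
  obtain ⟨E, hE⟩ := hL
  have hu' : ladder G v₀ u = L := hu
  obtain ⟨x, hx, rfl⟩ := exists_adj_of_mem_ladder (hu' ▸ hE)
  refine le_trans ?_ (hG.two_mul_ncard_compl_nearer_le hv₀ hx)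
  gcongr
  refine Set.ncard_le_ncard fun y hy => ?_
  have hy' : ladder G v₀ y = L := hy
  rw [Set.mem_compl_iff, ← hG.thetaOf_mem_ladder_iff hx, hy']
  exact hE

end Finite

/-! ### Shortest paths along ladder sequences -/

/-- Shortest paths from gate to gate are concatenated. Each withdrawn class is missing from the
ladder set of `m`, so each gate lies between the current vertex and `m` and the total length stays
minimal. The map `k` records the positions of the gates on the walk. -/
theorem IsMedianGraph.exists_walk_through_fibers (hG : IsMedianGraph G) {m : V} (r : ℕ) (u : V)
    (M : ℕ → Set (ThetaClass G)) (h0 : M 0 = ladder G v₀ u) (hr : M r = ladder G v₀ m)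
    (hM : ∀ i < r, ∃ E ∈ M i \ ladder G v₀ m, M (i + 1) = M i \ {E}) :
    ∃ (p : G.Walk u m) (k : ℕ → ℕ), p.length = G.dist u m ∧ Monotone k ∧ k r = p.length ∧
      (∀ i, k i ≤ p.length) ∧ ∀ i ≤ r, p.getVert (k i) ∈ ladderFiber G v₀ (M i) := by
  induction r generalizing u M with
  | zero =>
    obtain ⟨p, hp⟩ := hG.connected.exists_walk_length_eq_dist u m
    refine ⟨p, fun _ => p.length, hp, monotone_const, rfl, fun _ => le_rfl, fun i hi => ?_⟩
    obtain rfl : i = 0 := by omega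
    rw [p.getVert_length]
    exact hr.symm
  | succ r ih =>
    obtain ⟨E, ⟨hE, hEm⟩, hM1⟩ := hM 0 (by omega)
    rw [h0] at hE
    obtain ⟨g, hg, hgm⟩ := hG.exists_ladder_gate hE
    have hg1 : ladder G v₀ g = M 1 := by rw [hM1, h0]; exact hg.1
    obtain ⟨q, k, hq, hk, hkr, hkl, hkM⟩ := ih g (fun i => M (i + 1)) hg1.symm hr
      fun i hi => hM (i + 1) (by omega)
    obtain ⟨p, hp⟩ := hG.connected.exists_walk_length_eq_dist u g
    refine ⟨p.append q, fun i => Nat.casesOn i 0 fun i => p.length + k i, ?_, ?_, ?_, ?_, ?_⟩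
    · rw [SimpleGraph.Walk.length_append, hp, hq]
      exact hgm m hEm
    · refine monotone_nat_of_le_succ fun i => ?_
      cases i with
      | zero => exact Nat.zero_le _
      | succ i => exact Nat.add_le_add_left (hk (Nat.le_succ i)) _
    · simp [hkr]
    · intro i
      cases i with
      | zero => exact Nat.zero_le _
      | succ i =>
        have := hkl i
        simp only [SimpleGraph.Walk.length_append]
        omega
    · intro i hi
      cases i with
      | zero =>
        change (p.append q).getVert 0 ∈ _
        rw [SimpleGraph.Walk.getVert_zero]
        exact h0.symm
      | succ i =>
        simpa [SimpleGraph.Walk.getVert_append] using hkM i (by omega)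

/-- Both halves of the sequence are descents to the median: the withdrawals from `u`, and the
additions read backwards from `v`. -/
theorem IsMedianGraph.exists_walk_through_ladderSequence (hG : IsMedianGraph G) {u v m : V}
    (hm : IsMedianOf G u v v₀ m) {r t : ℕ} {L : ℤ → Set (ThetaClass G)}
    (hL : IsLadderSequence (ladder G v₀ u) (ladder G v₀ v) r t L) :
    ∃ (p : G.Walk u v) (k : ℤ → ℕ), p.length = G.dist u v ∧ Monotone k ∧
      (∀ i : ℤ, -(r : ℤ) ≤ i → i ≤ t →
        k i ≤ p.length ∧ p.getVert (k i) ∈ ladderFiber G v₀ (L i)) ∧ p.getVert (k 0) = m := by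
  have hlm := hG.ladder_median hm
  obtain ⟨p, k, hp, hk, hkr, hkl, hkM⟩ := hG.exists_walk_through_fibers (v₀ := v₀) (m := m) r u
    (fun i => L ((i : ℤ) - r)) (by simpa using hL.first) (by simpa [hlm] using hL.middle)
    (fun i hi => by
      obtain ⟨E, hE, h⟩ := hL.withdraw (r - 1 - i) (by omega)
      have e : -(((r - 1 - i : ℕ) : ℤ) + 1) = i - r := by omega
      have e' : -((r - 1 - i : ℕ) : ℤ) = (i + 1 : ℕ) - r := by omega
      rw [e] at hE h
      rw [e'] at h
      exact ⟨E, ⟨hE.1, fun h => hE.2 (hlm ▸ h).2⟩, h⟩)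
  obtain ⟨q, l, hq, hl, hlt, hll, hlM⟩ := hG.exists_walk_through_fibers (v₀ := v₀) (m := m) t v
    (fun i => L ((t : ℤ) - i)) (by simpa using hL.last) (by simpa [hlm] using hL.middle)
    (fun i hi => by
      obtain ⟨E, hE, h⟩ := hL.add (t - 1 - i) (by omega)
      have e : ((t - 1 - i : ℕ) : ℤ) + 1 = t - i := by omega
      have e' : ((t - 1 - i : ℕ) : ℤ) = t - (i + 1 : ℕ) := by omega
      rw [e] at hE h
      rw [e'] at h
      exact ⟨E, ⟨hE.1, fun h => hE.2 (hlm ▸ h).1⟩, h⟩)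
  have hlen : (p.append q.reverse).length = p.length + q.length := by simp
  -- For `i ≤ 0` the position on `p` after `r + i` withdrawals; for `i > 0` the position on `q`
  -- after `t - i` withdrawals, counted from the other end.
  refine ⟨p.append q.reverse, fun i => if i ≤ 0 then k (r + i).toNat else
    p.length + (q.length - l (t - i).toNat), ?_, ?_, ?_, ?_⟩
  · have h := hm.1.1
    rw [mem_interval] at h
    rw [hlen, hp, hq, ← h, G.dist_comm (u := v)]
  · intro i j hij
    dsimp only
    split_ifs with hi hj hj
    · exact hk (by omega)
    · exact (hkl _).trans (Nat.le_add_right _ _)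
    · omega
    · have := hl (show (t - j : ℤ).toNat ≤ (t - i).toNat by omega)
      omega
  · intro i hi hit
    have h1 := hkl (r + i).toNat
    rw [hlen]
    dsimp only
    split_ifs with h
    · refine ⟨by omega, ?_⟩
      have h2 := hkM (r + i).toNat (by omega)
      rw [show (((r + i).toNat : ℕ) : ℤ) - r = i by omega] at h2
      rcases h1.lt_or_eq with h3 | h3
      · rwa [SimpleGraph.Walk.getVert_append, if_pos h3]
      · rw [h3, SimpleGraph.Walk.getVert_length] at h2
        simpa [SimpleGraph.Walk.getVert_append, h3] using h2
    · refine ⟨by omega, ?_⟩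
      have h2 := hlM (t - i).toNat (by omega)
      rw [show (t : ℤ) - ((t - i).toNat : ℕ) = i by omega] at h2
      have h3 := hll (t - i).toNat
      rw [SimpleGraph.Walk.getVert_append, if_neg (by omega), SimpleGraph.Walk.getVert_reverse]
      convert h2 using 2
      omega
  · simp [hkr, SimpleGraph.Walk.getVert_append]

end Ladders

/-! ### Existence of labelings -/

theorem exists_isLabeling (w : ℕ) (V : Type u) [Finite V] (G : SimpleGraph V)
    (hG : IsMedianGraph G) (ident : V → ℕ) : ∃ Λ : V → List Bool, IsLabeling w G ident Λ := by
  classical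
  induction hn : Nat.card V using Nat.strong_induction_on generalizing V with
  | _ n ih =>
  -- A proper convex subset is either empty, and then falls under the trivial case, or a smaller
  -- median graph.
  have sub : ∀ S : Set V, IsConvex G S → ∀ x, x ∉ S →
      ∃ Λ : S → List Bool, IsLabeling w (G.induce S) (fun x => ident x) Λ := by
    intro S hS x hx
    rcases S.eq_empty_or_nonempty with h | h
    · exact ⟨fun _ => [], .small _ _ _ (by simp [h]) fun _ => rfl⟩
    · exact ih (Nat.card S) (hn ▸ Finite.card_subtype_lt (p := (· ∈ S)) hx) S _
        (hS.induce_isMedianGraph hG h) _ rfl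
  by_cases hsmall : Nat.card V ≤ 2
  · exact ⟨fun _ => [], .small _ _ _ hsmall fun _ => rfl⟩
  by_cases hU : IsUnbalanced G
  · have := hG.connected.nonempty
    obtain ⟨v₀, hv₀⟩ := Finite.exists_min fun v => ∑ᶠ y, G.dist v y
    have hgate : ∀ (x : V) (E : ThetaClass G), ∃ g, E ∈ ladder G v₀ x →
        IsGate G (ladderFiber G v₀ (ladder G v₀ x \ {E})) x g := fun x E => by
      by_cases hE : E ∈ ladder G v₀ x
      · obtain ⟨g, hg, -⟩ := hG.exists_ladder_gate hE
        exact ⟨g, fun _ => hg⟩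
      · exact ⟨x, fun h => absurd h hE⟩
    choose gate hgate using hgate
    have hrec : ∀ L : Set (ThetaClass G), ∃ Λr : ladderFiber G v₀ L → List Bool, L.Nonempty →
        IsLabeling w (G.induce (ladderFiber G v₀ L)) (fun x => ident x) Λr := fun L => by
      by_cases hL : L.Nonempty
      · obtain ⟨Λr, h⟩ := sub _ (hG.isConvex_ladderFiber L) v₀ fun h => by
          rw [← show ladder G v₀ v₀ = L from h, ladder_self] at hL
          exact Set.not_nonempty_empty hL
        exact ⟨Λr, fun _ => h⟩
      · exact ⟨fun _ => [], fun h => absurd h hL⟩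
    choose Λr hΛr using hrec
    let index := Finite.equivFin (ThetaClass G)
    let lad : V → List (ThetaClass G) := fun x => (ladder G v₀ x).toFinite.toFinset.toList
    refine ⟨fun x => if x = v₀ then [] else
      unbalancedBlock w ((lad x).map fun E => (index E : ℕ)) (G.dist v₀ x)
        ((lad x).map fun E => ((index E : ℕ), ident (gate x E), G.dist x (gate x E))) ++
        Λr (ladder G v₀ x) ⟨x, rfl⟩, ?_⟩
    exact .unbalanced G ident _ (by omega) hU index v₀ hv₀ lad (fun x => Finset.nodup_toList _)
      (fun x E => by simp [lad]) gate hgate Λr hΛr (by simp) fun x hx => by simp [hx]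
  · simp only [IsUnbalanced, not_forall, not_not] at hU
    obtain ⟨E, hE⟩ := hU
    obtain ⟨a, b, hab, rfl⟩ := exists_thetaOf_eq E
    have hc := hG.isConvex_nearer hab
    have hc' := hG.isConvex_not_nearer hab
    obtain ⟨Λ₁, h₁⟩ := sub _ hc b right_not_mem_nearer
    obtain ⟨Λ₂, h₂⟩ := sub _ hc' a fun h => h (left_mem_nearer hab)
    choose g₁ hg₁ using hc.exists_isGate hG ⟨a, left_mem_nearer hab⟩
    choose g₂ hg₂ using hc'.exists_isGate hG ⟨b, right_not_mem_nearer⟩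
    let gate : V → V := fun x => if x ∈ nearer G a b then g₂ x else g₁ x
    let index := Finite.equivFin (ThetaClass G)
    refine ⟨fun x => if h : x ∈ nearer G a b then
      balancedBlock w (index (thetaOf hab)) false (ident (gate x)) (G.dist x (gate x)) ++ Λ₁ ⟨x, h⟩
      else
      balancedBlock w (index (thetaOf hab)) true (ident (gate x)) (G.dist x (gate x)) ++ Λ₂ ⟨x, h⟩,
      ?_⟩
    refine .balanced G ident _ (by omega) index _ hE (nearer G a b) (nearer G a b)ᶜ
      ((hG.isHalfspace_iff hab).2 (.inl rfl)) ((hG.isHalfspace_iff hab).2 (.inr ?_)) rfl gate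
      (fun x hx => ?_) (fun x hx => ?_) Λ₁ Λ₂ h₁ h₂ (fun x hx => by simp [hx]) (fun x hx => ?_)
    · exact hG.nearer_compl hab
    · simpa [gate, hx] using hg₂ x
    · rw [Set.mem_compl_iff] at hx
      simpa [gate, hx] using hg₁ x
    · rw [Set.mem_compl_iff] at hx
      simp [hx]

/-! ### Reasoning about programs -/

section Logic

variable {W : ℕ} {labels : ℕ → List Bool} {P Q : Prog} {s : ℕ → ℕ} {T T₁ T₂ : ℕ}
  {R R' : (ℕ → ℕ) → Prop}

/-- Started on the memory `s`, the program `P` halts within `T` steps in a memory satisfying `R`. -/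
def RunsWithin (W : ℕ) (labels : ℕ → List Bool) (P : Prog) (s : ℕ → ℕ) (T : ℕ)
    (R : (ℕ → ℕ) → Prop) : Prop :=
  ∃ t s', Runs W labels P s t s' ∧ t ≤ T ∧ R s'

theorem RunsWithin.le (h : RunsWithin W labels P s T₁ R) (hT : T₁ ≤ T) :
    RunsWithin W labels P s T R :=
  let ⟨t, s', h1, h2, h3⟩ := h
  ⟨t, s', h1, h2.trans hT, h3⟩

theorem RunsWithin.imp (h : RunsWithin W labels P s T R) (hR : ∀ s', R s' → R' s') :
    RunsWithin W labels P s T R' :=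
  let ⟨t, s', h1, h2, h3⟩ := h
  ⟨t, s', h1, h2, hR _ h3⟩

theorem RunsWithin.skip (h : R s) : RunsWithin W labels .skip s 1 R :=
  ⟨1, s, .skip s, le_rfl, h⟩

theorem RunsWithin.seq (h : RunsWithin W labels P s T₁ R)
    (h' : ∀ s', R s' → RunsWithin W labels Q s' T₂ R') :
    RunsWithin W labels (.seq P Q) s (T₁ + T₂) R' :=
  let ⟨_, s', h1, h2, h3⟩ := h
  let ⟨_, s'', h4, h5, h6⟩ := h' s' h3
  ⟨_, s'', .seq h1 h4, add_le_add h2 h5, h6⟩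

theorem RunsWithin.cond_true {a : ℕ} (ha : s a ≠ 0) (h : RunsWithin W labels P s T R) :
    RunsWithin W labels (.cond a P Q) s (T + 1) R :=
  let ⟨_, s', h1, h2, h3⟩ := h
  ⟨_, s', .cond_true ha h1, Nat.succ_le_succ h2, h3⟩

theorem RunsWithin.cond_false {a : ℕ} (ha : s a = 0) (h : RunsWithin W labels Q s T R) :
    RunsWithin W labels (.cond a P Q) s (T + 1) R :=
  let ⟨_, s', h1, h2, h3⟩ := h
  ⟨_, s', .cond_false ha h1, Nat.succ_le_succ h2, h3⟩

theorem RunsWithin.cond {a : ℕ} (h : s a ≠ 0 → RunsWithin W labels P s T₁ R)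
    (h' : s a = 0 → RunsWithin W labels Q s T₂ R) :
    RunsWithin W labels (.cond a P Q) s (T₁ + T₂ + 1) R := by
  by_cases ha : s a = 0
  · exact (RunsWithin.cond_false ha (h' ha)).le (by omega)
  · exact (RunsWithin.cond_true ha (h ha)).le (by omega)

theorem RunsWithin.loop_false {a : ℕ} (ha : s a = 0) (h : R s) :
    RunsWithin W labels (.loop a P) s 1 R :=
  ⟨_, s, .loop_false ha, le_rfl, h⟩

theorem RunsWithin.loop_true {a : ℕ} (ha : s a ≠ 0) (h : RunsWithin W labels P s T₁ R)
    (h' : ∀ s', R s' → RunsWithin W labels (.loop a P) s' T₂ R') :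
    RunsWithin W labels (.loop a P) s (T₁ + 1 + T₂) R' := by
  obtain ⟨t, s', h1, h2, h3⟩ := h
  obtain ⟨t', s'', h4, h5, h6⟩ := h' s' h3
  exact ⟨_, s'', .loop_true ha h1 h4, by omega, h6⟩

/-- `I k` is the loop invariant with exactly `k` iterations still to come. -/
theorem RunsWithin.loop_count {a : ℕ} (I : ℕ → (ℕ → ℕ) → Prop)
    (hI : ∀ k s, I (k + 1) s → s a ≠ 0 ∧ RunsWithin W labels P s T (I k))
    (h0 : ∀ s, I 0 s → s a = 0) (k : ℕ) (hs : I k s) :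
    RunsWithin W labels (.loop a P) s (k * (T + 1) + 1) (I 0) := by
  induction k generalizing s with
  | zero => exact (loop_false (h0 s hs) hs).le (by omega)
  | succ k ih =>
    obtain ⟨ha, h⟩ := hI k s hs
    exact (loop_true ha h fun s' hs' => ih hs').le (by rw [Nat.succ_mul]; omega)

/-- `I l` is the loop invariant with the entries of `l` still to be processed, one per iteration. -/
theorem RunsWithin.loop_list {α : Type*} {a : ℕ} (I : List α → (ℕ → ℕ) → Prop)
    (hI : ∀ x l s, I (x :: l) s → s a ≠ 0 ∧ RunsWithin W labels P s T (I l))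
    (h0 : ∀ s, I [] s → s a = 0) (l : List α) (hs : I l s) :
    RunsWithin W labels (.loop a P) s (l.length * (T + 1) + 1) (I []) := by
  induction l generalizing s with
  | nil => exact (loop_false (h0 s hs) hs).le (by omega)
  | cons x l ih =>
    obtain ⟨ha, h⟩ := hI x l s hs
    exact (loop_true ha h fun s' hs' => ih hs').le (by rw [List.length_cons, Nat.succ_mul]; omega)

/-- The programs of a list, one after the other. -/
def block : List Prog → Prog
  | [] => .skip
  | P :: l => .seq P (block l)

/-- `[d] := k` -/
def const (d k : ℕ) : Prog := .instr (.const d k)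
/-- `[d] := [a] + [b]` -/
def add (d a b : ℕ) : Prog := .instr (.add d a b)
/-- `[d] := [a] - [b]` -/
def sub (d a b : ℕ) : Prog := .instr (.sub d a b)
/-- `[d] :=` the bit number `[b]` of the label of identity `[a]` -/
def probe (d a b : ℕ) : Prog := .instr (.probe d a b)

variable {l : List Prog}

theorem RunsWithin.nil (h : R s) : RunsWithin W labels (block []) s 1 R := .skip h

theorem RunsWithin.cons (h : RunsWithin W labels P s T₁ R)
    (h' : ∀ s', R s' → RunsWithin W labels (block l) s' T₂ R') :
    RunsWithin W labels (block (P :: l)) s (T₁ + T₂) R' := h.seq h'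

theorem write_of_lt {d x : ℕ} (h : x < 2 ^ W) : write W s d x = Function.update s d x := by
  rw [write, Nat.mod_eq_of_lt h]

theorem RunsWithin.const {d k : ℕ} (h : k < 2 ^ W)
    (h' : RunsWithin W labels (block l) (Function.update s d k) T R) :
    RunsWithin W labels (block (MedianOracle.const d k :: l)) s (T + 1) R :=
  (RunsWithin.cons ⟨1, _, .instr _ _, le_rfl, rfl⟩ fun s' hs' => by
    rw [← hs', Instr.exec, write_of_lt h]
    exact h').le (add_comm 1 T).le

theorem RunsWithin.add {d a b : ℕ} (x : ℕ) (hx : s a + s b = x) (h : x < 2 ^ W)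
    (h' : RunsWithin W labels (block l) (Function.update s d x) T R) :
    RunsWithin W labels (block (MedianOracle.add d a b :: l)) s (T + 1) R :=
  (RunsWithin.cons ⟨1, _, .instr _ _, le_rfl, rfl⟩ fun s' hs' => by
    rw [← hs', Instr.exec, hx, write_of_lt h]
    exact h').le (add_comm 1 T).le

theorem RunsWithin.sub {d a b : ℕ} (x : ℕ) (hx : s a - s b = x) (h : x < 2 ^ W)
    (h' : RunsWithin W labels (block l) (Function.update s d x) T R) :
    RunsWithin W labels (block (MedianOracle.sub d a b :: l)) s (T + 1) R :=
  (RunsWithin.cons ⟨1, _, .instr _ _, le_rfl, rfl⟩ fun s' hs' => by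
    rw [← hs', Instr.exec, hx, write_of_lt h]
    exact h').le (add_comm 1 T).le

theorem bitAt_le_two (l : List Bool) (i : ℕ) : bitAt l i ≤ 2 := by
  rw [bitAt]
  split <;> omega

theorem RunsWithin.probe {d a b : ℕ} (x : ℕ) (hx : bitAt (labels (s a)) (s b) = x) (hW : 2 ≤ W)
    (h' : RunsWithin W labels (block l) (Function.update s d x) T R) :
    RunsWithin W labels (block (MedianOracle.probe d a b :: l)) s (T + 1) R :=
  (RunsWithin.cons ⟨1, _, .instr _ _, le_rfl, rfl⟩ fun s' hs' => by
    have h : x < 2 ^ W := hx ▸ (bitAt_le_two _ _).trans_lt ((by norm_num : 2 < 2 ^ 2).trans_le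
      (Nat.pow_le_pow_right (by norm_num) hW))
    rw [← hs', Instr.exec, hx, write_of_lt h]
    exact h').le (add_comm 1 T).le

end Logic

/-! ### Reading numbers -/

section Read

theorem length_bits (w x : ℕ) : (bits w x).length = w := by
  induction w with
  | zero => rfl
  | succ w ih => rw [bits, List.length_cons, ih]

theorem length_flatMap_bits (w : ℕ) (l : List ℕ) : (l.flatMap (bits w)).length = l.length * w := by
  induction l with
  | nil => simp
  | cons x l ih => rw [List.flatMap_cons, List.length_append, length_bits, ih, List.length_cons]; ring

theorem bitAt_of_drop_eq {l : List Bool} {i : ℕ} {b : Bool} {m : List Bool}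
    (h : l.drop i = b :: m) : bitAt l i = b.toNat := by
  have : l[i]? = some b := by rw [← List.head?_drop, h]; rfl
  rw [bitAt, this]
  cases b <;> rfl

theorem bitAt_of_drop_eq_nil {l : List Bool} {i : ℕ} (h : l.drop i = []) : bitAt l i = 2 := by
  have : l[i]? = none := by rw [← List.head?_drop, h]; rfl
  rw [bitAt, this]

/-- Labels are parsed through equations `l.drop i = field ++ rest`; this moves the position behind
one field. -/
theorem drop_add_of_drop_eq {α : Type*} {l m r : List α} {i j : ℕ} (h : l.drop i = m ++ r)
    (hj : m.length = j) : l.drop (i + j) = r := by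
  rw [← List.drop_drop, h, ← hj, List.drop_left]

/-- The Horner step for bits read most significant first. -/
theorem div_two_pow_eq (x k : ℕ) :
    x / 2 ^ k = x / 2 ^ (k + 1) + x / 2 ^ (k + 1) + (x.testBit k).toNat := by
  rw [Nat.testBit_eq_decide_div_mod_eq, pow_succ, ← Nat.div_div_eq_div_mul]
  have := Nat.div_add_mod (x / 2 ^ k) 2
  rcases Nat.mod_two_eq_zero_or_one (x / 2 ^ k) with h | h <;> simp [h] <;> omega

/-- Registers used throughout: `3` contains `1`, `4` contains `0`, `5` contains the length `w` of
the numbers in the labels. -/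
structure Constants (w : ℕ) (s : ℕ → ℕ) : Prop where
  one : s 3 = 1
  zero : s 4 = 0
  width : s 5 = w

theorem Constants.of_frame {w N : ℕ} {s s' : ℕ → ℕ} (hN : 6 ≤ N) (h : Constants w s)
    (hs : ∀ r < N, s' r = s r) : Constants w s' :=
  ⟨(hs 3 (by omega)).trans h.one, (hs 4 (by omega)).trans h.zero,
    (hs 5 (by omega)).trans h.width⟩

/-- Read into register `23` a number from the label of identity `[21]`, starting at the position
`[22]`, which is moved behind the number. -/
def readNumber : Prog := block [const 23 0, add 24 5 4, .loop 24 (block [add 23 23 23,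
  probe 25 21 22, add 23 23 25, add 22 22 3, sub 24 24 3])]

variable {W w : ℕ} {labels : ℕ → List Bool} {s : ℕ → ℕ}

theorem readNumber_spec (hW : w + 2 ≤ W) (hs : Constants w s) {x : ℕ} (hx : x < 2 ^ w)
    {rest : List Bool} (hl : (labels (s 21)).drop (s 22) = bits w x ++ rest)
    (hb : s 22 + w < 2 ^ W) :
    RunsWithin W labels readNumber s (7 * w + 4) fun s' => s' 23 = x ∧ s' 22 = s 22 + w ∧
      ∀ r < 22, s' r = s r := by
  have hwW : 2 ^ w < 2 ^ W := Nat.pow_lt_pow_right (by norm_num) (by omega)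
  have hw : w < 2 ^ W := Nat.lt_two_pow_self.trans hwW
  obtain ⟨h3, h4, h5⟩ := hs
  apply RunsWithin.le
  -- With `k` bits still unread, register `23` contains `x / 2 ^ k`.
  · refine .const (by positivity) (.add w (by simp [h4, h5]) hw (.cons (RunsWithin.loop_count
      (T := 6) (fun k s' => s' 23 = x / 2 ^ k ∧ s' 22 + k = s 22 + w ∧ s' 24 = k ∧ k ≤ w ∧
        (labels (s 21)).drop (s' 22) = bits k x ++ rest ∧ ∀ r < 22, s' r = s r)
      ?_ ?_ w ?_) fun s' h => .nil ?_))
    · rintro k s' ⟨i1, i2, i3, i4, i5, i6⟩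
      refine ⟨by omega, ?_⟩
      have hdiv := div_two_pow_eq x k
      have hle : x / 2 ^ k ≤ x := Nat.div_le_self _ _
      have hbit := bitAt_of_drop_eq i5
      have h21 := i6 21 (by omega)
      have h3' := i6 3 (by omega)
      refine .add _ rfl (by omega) (.probe (x.testBit k).toNat (by simp [h21, hbit]) (by omega)
        (.add (x / 2 ^ k) (by simp; omega) (by omega) (.add (s' 22 + 1) (by simp [h3', h3])
        (by omega) (.sub k (by simp [h3', h3, i3]) (by omega) (.nil ?_)))))
      refine ⟨by simp, by simp; omega, by simp, by omega, ?_, fun r hr => ?_⟩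
      · simpa using drop_add_of_drop_eq (m := [x.testBit k]) i5 rfl
      · simp [show r ≠ 22 by omega, show r ≠ 23 by omega, show r ≠ 24 by omega,
          show r ≠ 25 by omega, i6 r hr]
    · exact fun s' h => h.2.2.1
    · refine ⟨by simp [Nat.div_eq_of_lt hx], by simp, by simp, le_rfl, by simpa using hl,
        fun r hr => ?_⟩
      simp [show r ≠ 23 by omega, show r ≠ 24 by omega]
    · exact ⟨by simpa using h.1, h.2.1, h.2.2.2.2.2⟩
  · omega

end Read

/-! ### Ladder sets in labels -/

section LadderLabels

/-- `l` is a label of an unbalanced graph, deprived of the blocks of the enclosing graphs, with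
ladder set `I` and triplets `Tr`; these are empty for the empty label of the median vertex. -/
structure IsLadderLabel (w : ℕ) (l : List Bool) (I : List ℕ) (Tr : List (ℕ × ℕ × ℕ)) : Prop where
  shape : (l = [] ∧ I = []) ∨ ∃ d rest, l = unbalancedBlock w I d Tr ++ rest
  length_le : I.length ≤ w
  length_eq : Tr.length = I.length
  index_lt : ∀ i ∈ I, i < 2 ^ w
  triplet_lt : ∀ p ∈ Tr, p.1 < 2 ^ w ∧ p.2.1 < 2 ^ w ∧ p.2.2 < 2 ^ w

/-- The part of a label that contains the triplets. -/
def tripletBits (w : ℕ) (Tr : List (ℕ × ℕ × ℕ)) : List Bool :=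
  Tr.flatMap fun p => bits w p.1 ++ bits w p.2.1 ++ bits w p.2.2

theorem length_tripletBits (w : ℕ) (Tr : List (ℕ × ℕ × ℕ)) :
    (tripletBits w Tr).length = Tr.length * (3 * w) := by
  induction Tr with
  | nil => simp [tripletBits]
  | cons p l ih =>
    rw [tripletBits] at ih ⊢
    rw [List.flatMap_cons, List.length_append, ih]
    simp only [List.length_append, length_bits, List.length_cons]
    ring

theorem unbalancedBlock_append (w : ℕ) (I : List ℕ) (d : ℕ) (Tr : List (ℕ × ℕ × ℕ))
    (rest : List Bool) : unbalancedBlock w I d Tr ++ rest =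
      false :: (bits w I.length ++ (I.flatMap (bits w) ++ (bits w d ++ (tripletBits w Tr ++ rest)))) := by
  simp [unbalancedBlock, tripletBits]

theorem length_unbalancedBlock (w : ℕ) (I : List ℕ) (d : ℕ) (Tr : List (ℕ × ℕ × ℕ)) :
    (unbalancedBlock w I d Tr).length = 1 + w + I.length * w + w + Tr.length * (3 * w) := by
  rw [← List.append_nil (unbalancedBlock w I d Tr), unbalancedBlock_append]
  simp only [List.length_cons, List.length_append, length_bits, length_flatMap_bits,
    length_tripletBits, List.length_nil]
  ring

/-- A bound for the length of any block, uniform in the ladder set, so that positions in labels can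
be shown not to overflow a word. -/
theorem block_length_bound {k w : ℕ} (h : k ≤ w) :
    1 + w + k * w + w + k * (3 * w) ≤ 4 * (w + 1) ^ 2 := by
  have := Nat.mul_le_mul_right w h
  nlinarith

/-- Test whether the number `[16]` occurs in the ladder set of the label of identity `[12]` at
position `[6]`; the answer is written into register `17`. -/
def testMember : Prog := block [const 17 0, probe 26 12 6, sub 26 26 3, .cond 26 .skip (block [
  add 21 12 4, add 22 6 3, readNumber, add 20 23 4, .loop 20 (block [readNumber,
    sub 26 23 16, sub 27 16 23, add 26 26 27, .cond 26 .skip (block [const 17 1]), sub 20 20 3])])]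

variable {W w : ℕ} {labels : ℕ → List Bool} {s : ℕ → ℕ} {I : List ℕ} {Tr : List (ℕ × ℕ × ℕ)}

theorem testMember_spec (hW : w + 2 ≤ W) (hs : Constants w s)
    (hl : IsLadderLabel w ((labels (s 12)).drop (s 6)) I Tr)
    (hb : s 6 + 4 * (w + 1) ^ 2 < 2 ^ W) (hq : s 12 < 2 ^ w) (hE : s 16 < 2 ^ w) :
    RunsWithin W labels testMember s (30 * (w + 1) ^ 2) fun s' =>
      (s' 17 ≠ 0 ↔ s 16 ∈ I) ∧ ∀ r < 17, s' r = s r := by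
  have hwW : 4 * 2 ^ w ≤ 2 ^ W := by
    rw [show 4 * 2 ^ w = 2 ^ (w + 2) by ring]
    exact Nat.pow_le_pow_right (by norm_num) hW
  have hw : w < 2 ^ w := Nat.lt_two_pow_self
  have hbound := block_length_bound hl.length_le
  obtain ⟨h3, h4, h5⟩ := hs
  rcases hl.shape with ⟨hnil, rfl⟩ | ⟨d, rest, hshape⟩
  -- Beyond the end of a label a probe returns `2`, so truncated subtraction of `1` gives a nonzero
  -- value exactly when no bit is left.
  · have hbit := bitAt_of_drop_eq_nil hnil
    apply RunsWithin.le
    · refine .const (by positivity) (.probe 2 (by simp [hbit]) (by omega)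
        (.sub 1 (by simp [h3]) (by omega) (.cons (R := fun s' =>
        (s' 17 ≠ 0 ↔ s 16 ∈ []) ∧ ∀ r < 17, s' r = s r) (.cond_true (by simp)
          (.skip ⟨by simp, fun r hr => ?_⟩)) fun s' h => .nil h)))
      simp [show r ≠ 17 by omega, show r ≠ 26 by omega]
    · nlinarith
  · rw [unbalancedBlock_append] at hshape
    have hbit := bitAt_of_drop_eq hshape
    have hl1 := drop_add_of_drop_eq (m := [false]) hshape rfl
    have hlen : I.length < 2 ^ w := hl.length_le.trans_lt hw
    have hl2 := drop_add_of_drop_eq hl1 (length_bits _ _)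
    apply RunsWithin.le
    · refine .const (by positivity) (.probe 0 (by simp [hbit]) (by omega)
        (.sub 0 (by simp) (by omega) (.cons (R := fun s' => (s' 17 ≠ 0 ↔ s 16 ∈ I) ∧
          ∀ r < 17, s' r = s r) (.cond_false (by simp)
        (.add (s 12) (by simp [h4]) (by omega) (.add (s 6 + 1) (by simp [h3]) (by omega)
        (.cons (readNumber_spec (by omega) ⟨by simp [h3], by simp [h4], by simp [h5]⟩ hlen
          (rest := I.flatMap (bits w) ++ (bits w d ++ (tripletBits w Tr ++ rest)))
          (by simpa using hl1) (by simp; omega))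
        fun s1 h1 => .add I.length ?_ (by omega)
        -- With the indices `l` unread, the number searched for is in the ladder set iff it was
        -- already found or occurs in `l`. Two numbers are equal iff their truncated differences in
        -- both orders add up to `0`.
        (.cons (RunsWithin.loop_list (T := 7 * w + 13) (fun l s' =>
              s' 20 = l.length ∧ (labels (s 12)).drop (s' 22) = l.flatMap (bits w) ++
                (bits w d ++ (tripletBits w Tr ++ rest)) ∧ s' 21 = s 12 ∧
              s' 22 + l.length * w < 2 ^ W ∧ (s' 17 ≠ 0 ∨ s 16 ∈ l ↔ s 16 ∈ I) ∧
              (∀ r < 17, s' r = s r) ∧ (∀ x ∈ l, x < 2 ^ w) ∧ l.length < 2 ^ w)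
              ?_ ?_ I ?_) fun s2 h2 => .nil ?_))))) fun s' h => .nil h)))
      · obtain ⟨j1, -, j3⟩ := h1
        rw [j1, j3 4 (by omega)]
        simp [h4]
      · rintro x l s' ⟨i1, i2, i3, i4, i5, i6, i7, i8⟩
        rw [List.length_cons] at i1 i8
        rw [List.length_cons, Nat.succ_mul] at i4
        have hx := i7 x (by simp)
        rw [List.flatMap_cons, List.append_assoc] at i2
        have h3' := i6 3 (by omega)
        have h4' := i6 4 (by omega)
        have h5' := i6 5 (by omega)
        have h16 := i6 16 (by omega)
        refine ⟨by omega, ?_⟩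
        apply RunsWithin.le
        · refine .cons (T₂ := 9) (readNumber_spec (by omega)
            ⟨h3'.trans h3, h4'.trans h4, h5'.trans h5⟩ hx (i3 ▸ i2) (by omega)) ?_
          rintro s1 ⟨j1, j2, j3⟩
          have g16 := j3 16 (by omega)
          have g20 := j3 20 (by omega)
          have g3 := j3 3 (by omega)
          have g17 := j3 17 (by omega)
          have g21 := j3 21 (by omega)
          refine .sub (x - s 16) (by omega) (by omega) (.sub (s 16 - x) (by simp; omega) (by omega)
            (.add (x - s 16 + (s 16 - x)) (by simp) (by omega) (.cons (R := fun s' =>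
            s' 20 = s1 20 ∧ s' 22 = s1 22 ∧ s' 21 = s1 21 ∧ (s' 17 ≠ 0 ↔ s1 17 ≠ 0 ∨ s 16 = x) ∧
            ∀ r < 17, s' r = s1 r) (.cond (T₁ := 1) (T₂ := 2) ?_ ?_) fun s2 h2 => .sub l.length
              ?_ (by omega) (.nil ?_))))
          · intro h
            refine .skip ⟨by simp, by simp, by simp, ?_, fun r hr => ?_⟩
            · simp at h ⊢
              intro h; omega
            · simp [show r ≠ 26 by omega, show r ≠ 27 by omega]
          · intro h
            refine .const (by omega) (.nil ⟨by simp, by simp, by simp, ?_, fun r hr => ?_⟩)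
            · simp at h ⊢
              right; omega
            · simp [show r ≠ 26 by omega, show r ≠ 27 by omega, show r ≠ 17 by omega]
          · have := h2.2.2.2.2 3 (by omega)
            omega
          · obtain ⟨k1, k2, k3, k4, k5⟩ := h2
            refine ⟨by simp, ?_, ?_, ?_, ?_, fun r hr => ?_, fun y hy => i7 y (by simp [hy]),
              by omega⟩
            · simpa [k2, j2] using drop_add_of_drop_eq i2 (length_bits _ _)
            · simp; omega
            · simp; omega
            · simp only [← i5, List.mem_cons, ne_eq]
              simp at k4
              simp [k4, g17]
              tauto
            · simp [show r ≠ 20 by omega, k5 r hr, j3 r (by omega), i6 r hr]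
        · omega
      · exact fun s' h => by simpa using h.1
      · obtain ⟨j1, j2, j3⟩ := h1
        have j17 := j3 17 (by omega)
        have j21 := j3 21 (by omega)
        simp at j2 j17 j21
        refine ⟨by simp, by simpa [j2] using hl2, by simp [j21], by simp [j2]; omega, by simp [j17],
          fun r hr => ?_, hl.index_lt, hlen⟩
        simp [show r ≠ 20 by omega, show r ≠ 22 by omega, show r ≠ 21 by omega,
          show r ≠ 26 by omega, show r ≠ 17 by omega, j3 r (by omega)]
      · exact ⟨by simpa using h2.2.2.2.2.1, h2.2.2.2.2.2.1⟩
    · have := Nat.mul_le_mul_right (7 * w + 13 + 1) hl.length_le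
      nlinarith

end LadderLabels

/-! ### Looking up gates in labels -/

section FindTriplet

/-- Look up the number `[16]` in the triplets of the label of identity `[13]` at position `[6]`;
the gate and the distance are written into the registers `18` and `19`. -/
def findTriplet : Prog := block [add 21 13 4, add 22 6 3, readNumber, add 20 23 4, add 28 23 4,
  add 22 22 5, .loop 28 (block [add 22 22 5, sub 28 28 3]), .loop 20 (block [readNumber,
    sub 26 23 16, sub 27 16 23, add 26 26 27,
    .cond 26 (block [add 22 22 5, add 22 22 5])
      (block [readNumber, add 18 23 4, readNumber, add 19 23 4]),
    sub 20 20 3])]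

variable {W w : ℕ} {labels : ℕ → List Bool} {s : ℕ → ℕ} {I : List ℕ} {Tr : List (ℕ × ℕ × ℕ)}

theorem findTriplet_spec (hW : w + 2 ≤ W) (hs : Constants w s)
    (hl : IsLadderLabel w ((labels (s 13)).drop (s 6)) I Tr)
    (hb : s 6 + 4 * (w + 1) ^ 2 < 2 ^ W) (hq : s 13 < 2 ^ w) (hE : s 16 < 2 ^ w) {g d : ℕ}
    (hmem : (s 16, g, d) ∈ Tr) (huniq : ∀ p ∈ Tr, p.1 = s 16 → p = (s 16, g, d)) :
    RunsWithin W labels findTriplet s (60 * (w + 1) ^ 2) fun s' =>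
      s' 18 = g ∧ s' 19 = d ∧ ∀ r < 18, s' r = s r := by
  have hwW : 4 * 2 ^ w ≤ 2 ^ W := by
    rw [show 4 * 2 ^ w = 2 ^ (w + 2) by ring]
    exact Nat.pow_le_pow_right (by norm_num) hW
  have hw : w < 2 ^ w := Nat.lt_two_pow_self
  have hbound := block_length_bound hl.length_le
  rcases hl.shape with ⟨hnil, hI⟩ | ⟨d', rest, hshape⟩
  -- An empty label has no triplets, so it contains no entry to look up.
  · have := hl.length_eq
    rw [hI, List.length_nil, List.length_eq_zero_iff] at this
    simp [this] at hmem
  rw [unbalancedBlock_append] at hshape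
  have hl1 := drop_add_of_drop_eq (m := [false]) hshape rfl
  have hlen : I.length < 2 ^ w := hl.length_le.trans_lt hw
  have hl2 := drop_add_of_drop_eq (drop_add_of_drop_eq hl1 (length_bits _ _))
    (length_flatMap_bits _ _)
  have hl3 := drop_add_of_drop_eq hl2 (length_bits _ _)
  apply RunsWithin.le
  · refine .add (s 13) (by simp [hs.zero]) (by omega) (.add (s 6 + 1) (by simp [hs.one]) (by omega)
      (.cons (R := fun s' => s' 23 = I.length ∧ s' 22 = s 6 + 1 + w ∧ s' 21 = s 13 ∧
        ∀ r < 18, s' r = s r) (T₂ := I.length * 4 + 1 + (I.length * (21 * w + 26) + 1 + 1) + 3)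
        ((readNumber_spec (by omega) ⟨by simp [hs.one], by simp [hs.zero], by simp [hs.width]⟩ hlen
          (rest := I.flatMap (bits w) ++ (bits w d' ++ (tripletBits w Tr ++ rest)))
          (by simpa using hl1) (by simp; omega)).imp ?_) ?_))
    · rintro s1 ⟨j1, j2, j3⟩
      refine ⟨j1, by simpa using j2, by simpa using j3 21 (by omega), fun r hr => ?_⟩
      simp [j3 r (by omega), show r ≠ 21 by omega, show r ≠ 22 by omega]
    · rintro s1 ⟨j1, j2, j3, j4⟩
      have h1 := hs.of_frame (by omega) j4
      refine .add I.length (by simp [j1, h1.zero]) (by omega) (.add I.length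
        (by simp [j1, h1.zero]) (by omega) (.add (s 6 + 1 + w + w) (by simp [j2, h1.width])
        (by omega) (.cons (R := fun s' => s' 22 = s 6 + 1 + w + I.length * w + w ∧
          s' 21 = s 13 ∧ s' 20 = I.length ∧ ∀ r < 18, s' r = s r)
          -- Skips the list of ladder indices by adding `w` to the position once per entry, as the
          -- machine has no multiplication.
          ((RunsWithin.loop_count (T := 3) (fun k s' => s' 28 = k ∧ k ≤ w ∧
            s' 22 + k * w = s 6 + 1 + w + I.length * w + w ∧ s' 21 = s 13 ∧
            s' 20 = I.length ∧ ∀ r < 18, s' r = s r) ?_ ?_ I.length ?_).imp ?_) ?_)))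
      · rintro k s' ⟨i1, i0, i2, i3, i4, i5⟩
        have h' := hs.of_frame (by omega) i5
        rw [Nat.succ_mul] at i2
        refine ⟨by omega, .add (s' 22 + w) (by simp [h'.width]) (by omega) (.sub k
          (by simp [h'.one, i1]) (by omega) (.nil ⟨by simp, by omega,
          by simp; omega, by simp [i3], by simp [i4], fun r hr => ?_⟩))⟩
        simp [i5 r hr, show r ≠ 22 by omega, show r ≠ 28 by omega]
      · exact fun s' h => h.1
      · refine ⟨by simp, hl.length_le, by simp; omega, by simp [j3], by simp, fun r hr => ?_⟩
        simp [j4 r hr, show r ≠ 22 by omega, show r ≠ 28 by omega, show r ≠ 20 by omega]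
      · rintro s2 ⟨-, -, i2, i3, i4, i5⟩
        exact ⟨by simpa using i2, i3, i4, i5⟩
      · rintro s2 ⟨k1, k2, k3, k4⟩
        rw [← hl.length_eq]
        -- The wanted triplet is either still unread or already copied into registers `18` and `19`.
        -- Uniqueness ensures that a match is the wanted triplet.
        refine .cons (RunsWithin.loop_list (T := 21 * w + 25) (fun l s' =>
          s' 20 = l.length ∧ (labels (s 13)).drop (s' 22) = tripletBits w l ++ rest ∧
          s' 21 = s 13 ∧ s' 22 + l.length * (3 * w) < 2 ^ W ∧
          ((s 16, g, d) ∈ l ∨ (s' 18 = g ∧ s' 19 = d)) ∧ (∀ p ∈ l, p ∈ Tr) ∧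
          (∀ r < 18, s' r = s r) ∧ l.length < 2 ^ w) ?_ ?_ Tr ?_) fun s3 h3 => .nil ?_
        · rintro p l s' ⟨i1, i2, i3, i4, i5, i6, i7, i8⟩
          rw [List.length_cons] at i1 i8
          rw [List.length_cons, Nat.succ_mul] at i4
          have hp := hl.triplet_lt p (i6 p (by simp))
          have h' := hs.of_frame (by omega) i7
          have h16 := i7 16 (by omega)
          rw [tripletBits, List.flatMap_cons, ← tripletBits] at i2
          simp only [List.append_assoc] at i2
          have hp1 := drop_add_of_drop_eq i2 (length_bits _ _)
          have hp2 := drop_add_of_drop_eq hp1 (length_bits _ _)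
          have hp3 := drop_add_of_drop_eq hp2 (length_bits _ _)
          refine ⟨by omega, ?_⟩
          apply RunsWithin.le
          · refine .cons (R := fun s1 => s1 23 = p.1 ∧ s1 22 = s' 22 + w ∧ ∀ r < 22, s1 r = s' r)
              (T₂ := 3 + (7 * w + 4 + (7 * w + 4 + 2 + 1)) + 1 + 2 + 3)
              (readNumber_spec (by omega) h' hp.1 (i3 ▸ i2) (by omega)) ?_
            rintro s1 ⟨j1, j2, j3⟩
            have h1 := h'.of_frame (by omega) j3
            have g16 := j3 16 (by omega)
            have g21 := j3 21 (by omega)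
            have g20 := j3 20 (by omega)
            refine .sub (p.1 - s 16) (by omega) (by omega) (.sub (s 16 - p.1) (by simp; omega)
              (by omega) (.add (p.1 - s 16 + (s 16 - p.1)) (by simp) (by omega) (.cons
              (T₁ := 3 + (7 * w + 4 + (7 * w + 4 + 2 + 1)) + 1) (T₂ := 2) (R := fun s'' =>
              s'' 20 = l.length + 1 ∧ s'' 22 = s' 22 + w + w + w ∧ s'' 21 = s 13 ∧
              (p.1 = s 16 → s'' 18 = p.2.1 ∧ s'' 19 = p.2.2) ∧
              (p.1 ≠ s 16 → s'' 18 = s' 18 ∧ s'' 19 = s' 19) ∧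
              ∀ r < 18, s'' r = s r) (.cond (T₁ := 3)
              (T₂ := 7 * w + 4 + (7 * w + 4 + 2 + 1)) ?_ ?_) fun s2 h2 =>
              .sub l.length ?_ (by omega) (.nil ?_))))
            · intro hne
              simp at hne
              refine .add (s' 22 + w + w) (by simp [j2, h1.width]) (by omega)
                (.add (s' 22 + w + w + w) (by simp [h1.width]) (by omega) (.nil
                ⟨by simp; omega, by simp, by simp; omega, by omega, fun _ => ⟨?_, ?_⟩,
                fun r hr => ?_⟩))
              · simp [j3 18 (by omega)]
              · simp [j3 19 (by omega)]
              · simp [show r ≠ 22 by omega, show r ≠ 26 by omega, show r ≠ 27 by omega,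
                  j3 r (by omega), i7 r hr]
            · intro heq
              simp at heq
              refine .cons (T₁ := 7 * w + 4) (T₂ := 7 * w + 4 + 2 + 1) (readNumber_spec (x := p.2.1)
                (rest := bits w p.2.2 ++ (tripletBits w l ++ rest)) (by omega) ⟨by simp [h1.one],
                by simp [h1.zero], by simp [h1.width]⟩ hp.2.1 (by simpa [g21, i3, j2] using hp1)
                (by simp; omega)) ?_
              rintro s2 ⟨k1, k2, k3⟩
              have a21 := k3 21 (by omega)
              simp at k2 a21
              have k3' : ∀ r < 22, s2 r = s1 r := fun r hr => by
                simp [k3 r hr, show r ≠ 26 by omega, show r ≠ 27 by omega]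
              have h2 := h1.of_frame (by omega) k3'
              refine .add p.2.1 (by simp [k1, h2.zero]) (by omega) (.cons (T₁ := 7 * w + 4) (T₂ := 2)
                (readNumber_spec (x := p.2.2) (rest := tripletBits w l ++ rest) (by omega)
                ⟨by simp [h2.one], by simp [h2.zero], by simp [h2.width]⟩ hp.2.2
                (by simpa [a21, g21, i3, j2, k2] using hp2) (by simp; omega)) ?_)
              rintro s3 ⟨l1, l2, l3⟩
              have b4 := l3 4 (by omega)
              have b18 := l3 18 (by omega)
              have b20 := l3 20 (by omega)
              have b21 := l3 21 (by omega)
              have a20 := k3' 20 (by omega)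
              simp at l2 b4 b18 b20 b21
              refine .add p.2.2 (by simp [l1, b4, h2.zero]) (by omega) (.nil
                ⟨by simp; omega, by simp; omega, by simp; omega, fun _ => ⟨by simp [b18], by simp⟩,
                by omega, fun r hr => ?_⟩)
              simp [show r ≠ 19 by omega, show r ≠ 18 by omega, l3 r (by omega), k3' r (by omega),
                j3 r (by omega), i7 r hr]
            · simp [h2.1, h2.2.2.2.2.2 3 (by omega), hs.one]
            · obtain ⟨k1, k2, k3, k4, k5, k6⟩ := h2
              refine ⟨by simp, by simpa [k2] using hp3, by simp [k3], by simp; omega, ?_,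
                fun q hq => i6 q (by simp [hq]), fun r hr => ?_, by omega⟩
              · by_cases h : p.1 = s 16
                · have hp' := huniq p (i6 p (by simp)) h
                  right
                  simpa [hp'] using k4 h
                · simp only [List.mem_cons] at i5
                  have hne : (s 16, g, d) ≠ p := fun h' => h (by rw [← h'])
                  simpa [hne, k5 h] using i5
              · simp [show r ≠ 20 by omega, k6 r hr]
          · omega
        · exact fun s' h => by simpa using h.1
        · refine ⟨by rw [k3, hl.length_eq], by rw [k1]; exact hl3, k2, ?_, .inl hmem,
            fun p hp => hp, k4, by rw [hl.length_eq]; exact hlen⟩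
          rw [k1, hl.length_eq]
          omega
        · have := h3.2.2.2.2.1
          simp only [List.not_mem_nil, false_or] at this
          exact ⟨this.1, this.2, h3.2.2.2.2.2.2.1⟩
  · have h1 := Nat.mul_le_mul_right (21 * w + 26) hl.length_le
    have := hl.length_le
    nlinarith

end FindTriplet

/-! ### Walking through gates to a common fiber -/

section Walk

/-- Walk from the vertex of identity `[11]` through gates until all classes of its ladder set that
do not belong to the ladder set of the vertex of identity `[12]` are withdrawn.  The final vertex is
written into register `13`, the length of the walk is added to register `7`. -/
def walkToCommonFiber : Prog := block [add 13 11 4, probe 26 11 6, sub 26 26 3,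
  .cond 26 .skip (block [add 21 11 4, add 22 6 3, readNumber, add 14 23 4, add 15 22 4,
    .loop 14 (block [add 21 11 4, add 22 15 4, readNumber, add 15 22 4, add 16 23 4, testMember,
      .cond 17 .skip (block [findTriplet, add 13 18 4, add 7 7 19]), sub 14 14 3])])]

variable {V : Type u} {G : SimpleGraph V} {v₀ : V} {W w off : ℕ} {labels : ℕ → List Bool}
  {ident : V → ℕ} {index : ThetaClass G → ℕ} {lad : V → List (ThetaClass G)}
  {gate : V → ThetaClass G → V} {s : ℕ → ℕ}

/-- From position `off` on, the labels describe the ladder sets of `G` with respect to `v₀`. -/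
structure IsLadderLevel (w : ℕ) (labels : ℕ → List Bool) (off : ℕ) (G : SimpleGraph V) (v₀ : V)
    (ident : V → ℕ) (index : ThetaClass G → ℕ) (lad : V → List (ThetaClass G))
    (gate : V → ThetaClass G → V) : Prop where
  index_injective : Function.Injective index
  nodup : ∀ x, (lad x).Nodup
  mem_lad : ∀ x E, E ∈ lad x ↔ E ∈ ladder G v₀ x
  isGate : ∀ x, ∀ E ∈ ladder G v₀ x,
    IsGate G (ladderFiber G v₀ (ladder G v₀ x \ {E})) x (gate x E)
  ident_lt : ∀ x, ident x < 2 ^ w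
  label : ∀ x, IsLadderLabel w ((labels (ident x)).drop off) ((lad x).map index)
    ((lad x).map fun E => (index E, ident (gate x E), G.dist x (gate x E)))

set_option maxHeartbeats 1000000 in
-- The loop runs over the ladder set of `p`. With the classes `l` still to be examined, the current
-- vertex `x` has ladder set `L_p ∩ (L_q ∪ l)`, and the accumulated length plus `d(x,q)` is
-- constant. The list is read from the label of `p`, but gates are looked up in the label of the
-- current vertex. At most `w` classes, each with a membership test and possibly a lookup of cost
-- `O(w²)`, give `O(w³)`.
theorem walkToCommonFiber_spec (hG : IsMedianGraph G)
    (hL : IsLadderLevel w labels off G v₀ ident index lad gate) (hW : w + 2 ≤ W)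
    (hs : Constants w s) {p q : V} (h11 : s 11 = ident p) (h12 : s 12 = ident q) (h6 : s 6 = off)
    (hb : off + 4 * (w + 1) ^ 2 < 2 ^ W) (hacc : s 7 + G.dist p q < 2 ^ W) :
    RunsWithin W labels walkToCommonFiber s (140 * (w + 1) ^ 3) fun s' => ∃ x : V,
      s' 13 = ident x ∧ ladder G v₀ x = ladder G v₀ p ∩ ladder G v₀ q ∧
      s' 7 + G.dist x q = s 7 + G.dist p q ∧ ∀ r < 13, r ≠ 7 → s' r = s r := by
  have hwW : 4 * 2 ^ w ≤ 2 ^ W := by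
    rw [show 4 * 2 ^ w = 2 ^ (w + 2) by ring]
    exact Nat.pow_le_pow_right (by norm_num) hW
  have hw : w < 2 ^ w := Nat.lt_two_pow_self
  have hp := hL.ident_lt p
  have hq := hL.ident_lt q
  have hlp := hL.label p
  have hlen := hlp.length_le
  rw [List.length_map] at hlen
  have hbound := block_length_bound hlen
  rcases hlp.shape with ⟨hnil, hI⟩ | ⟨d, rest, hshape⟩
  · have hbit := bitAt_of_drop_eq_nil hnil
    have hpe : ladder G v₀ p = ∅ := by
      ext E
      rw [← hL.mem_lad, List.map_eq_nil_iff.1 hI]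
      simp
    apply RunsWithin.le
    · refine .add (ident p) (by simp [h11, hs.zero]) (by omega) (.probe 2 (by simp [h11, h6, hbit])
        (by omega) (.sub 1 (by simp [hs.one]) (by omega) (.cons (.cond_true (by simp)
        (.skip ?_)) fun s' h => .nil h)))
      refine ⟨p, by simp, by simp [hpe], by simp, fun r hr _ => ?_⟩
      simp [show r ≠ 13 by omega, show r ≠ 26 by omega]
    · nlinarith [Nat.one_le_pow 3 (w + 1) (by omega)]
  · rw [unbalancedBlock_append, List.length_map] at hshape
    have hbit := bitAt_of_drop_eq hshape
    have hl1 := drop_add_of_drop_eq (m := [false]) hshape rfl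
    have hl2 := drop_add_of_drop_eq hl1 (length_bits _ _)
    set rest' := bits w d ++ (tripletBits w
      ((lad p).map fun E => (index E, ident (gate p E), G.dist p (gate p E))) ++ rest)
    have hlen' : (lad p).length < 2 ^ w := hlen.trans_lt hw
    apply RunsWithin.le
    · refine .add (ident p) (by simp [h11, hs.zero]) (by omega) (.probe 0 (by simp [h11, h6, hbit])
        (by omega) (.sub 0 (by simp) (by omega) (.cons
        (T₁ := 7 * w + 4 + ((lad p).length * (110 * (w + 1) ^ 2 + 1) + 1 + 1 + 2) + 2 + 1) (T₂ := 1)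
        (.cond_false (by simp) (.add (ident p) (by simp [h11, hs.zero]) (by omega)
        (.add (off + 1) (by simp [h6, hs.one]) (by omega) (.cons (T₁ := 7 * w + 4)
        (readNumber_spec (rest := ((lad p).map index).flatMap (bits w) ++ rest') (by omega)
          ⟨by simp [hs.one], by simp [hs.zero], by simp [hs.width]⟩ hlen'
          (by simpa using hl1) (by simp; omega)) ?_)))) fun s' h => .nil h)))
      rintro s1 ⟨j1, j2, j3⟩
      have j2' : s1 22 = off + 1 + w := by simpa using j2
      have j13 := j3 13 (by omega)
      simp at j13
      have j4 : ∀ r < 13, s1 r = s r := fun r hr => by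
        simp [j3 r (by omega), show r ≠ 22 by omega, show r ≠ 21 by omega, show r ≠ 26 by omega,
          show r ≠ 13 by omega]
      have h1 := hs.of_frame (by omega) j4
      refine .add (lad p).length (by simp [j1, h1.zero]) (by omega) (.add (off + 1 + w)
        (by simp [j2', h1.zero]) (by omega) (.cons
        (T₁ := (lad p).length * (110 * (w + 1) ^ 2 + 1) + 1) (T₂ := 1) (RunsWithin.loop_list (T := 110 * (w + 1) ^ 2)
        (fun l s' => (∃ x, s' 13 = ident x ∧
            ladder G v₀ x = ladder G v₀ p ∩ (ladder G v₀ q ∪ {E | E ∈ l}) ∧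
            s' 7 + G.dist x q = s 7 + G.dist p q) ∧ s' 14 = l.length ∧
          (labels (ident p)).drop (s' 15) = (l.map index).flatMap (bits w) ++ rest' ∧
          s' 15 + l.length * w < 2 ^ W ∧ (∀ E ∈ l, E ∈ lad p) ∧ l.Nodup ∧
          l.length < 2 ^ w ∧ ∀ r < 13, r ≠ 7 → s' r = s r) ?_ ?_ (lad p) ?_)
        fun s2 h2 => .nil ?_))
      · rintro E l s' ⟨⟨x, hx, hlx, hdx⟩, i1, i2, i3, i4, i5, i6, i7⟩
        rw [List.length_cons] at i1 i6
        rw [List.length_cons, Nat.succ_mul] at i3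
        rw [List.map_cons, List.flatMap_cons, List.append_assoc] at i2
        have hE : index E < 2 ^ w := hlp.index_lt _ (List.mem_map_of_mem (i4 E (by simp)))
        have hEp : E ∈ ladder G v₀ p := (hL.mem_lad p E).1 (i4 E (by simp))
        have hs' : Constants w s' := ⟨by rw [i7 3 (by omega) (by omega), hs.one],
          by rw [i7 4 (by omega) (by omega), hs.zero], by rw [i7 5 (by omega) (by omega), hs.width]⟩
        refine ⟨by omega, ?_⟩
        have g11 := i7 11 (by omega) (by omega)
        apply RunsWithin.le
        · refine .add (ident p) (by simp [g11, h11, hs'.zero]) (by omega) (.add (s' 15)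
            (by simp [hs'.zero]) (by omega) (.cons (T₁ := 7 * w + 4)
            (T₂ := 30 * (w + 1) ^ 2 + (1 + (60 * (w + 1) ^ 2 + 3) + 1 + 2) + 1 + 1)
            (R := fun s1 => s1 23 = index E ∧ s1 22 = s' 15 + w ∧ ∀ r < 20, s1 r = s' r)
            ((readNumber_spec (by omega) ⟨by simp [hs'.one], by simp [hs'.zero],
              by simp [hs'.width]⟩ hE (by simpa using i2) (by simp; omega)).imp ?_) ?_))
          · rintro s1 ⟨j1, j2, j3⟩
            refine ⟨j1, by simpa using j2, fun r hr => ?_⟩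
            simp [j3 r (by omega), show r ≠ 21 by omega, show r ≠ 22 by omega]
          rintro s1 ⟨j1, j2, j3⟩
          have h1 := hs'.of_frame (by omega) j3
          refine .add (s' 15 + w) (by simp [j2, h1.zero]) (by omega) (.add (index E)
            (by simp [j1, h1.zero]) (by omega) (.cons
            (R := fun s2 => (s2 17 ≠ 0 ↔ E ∈ ladder G v₀ q) ∧ s2 16 = index E ∧
              s2 15 = s' 15 + w ∧ ∀ r < 15, s2 r = s' r)
            (T₁ := 30 * (w + 1) ^ 2)
            (T₂ := 1 + (60 * (w + 1) ^ 2 + 3) + 1 + 2)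
            ((testMember_spec (I := (lad q).map index) (Tr := (lad q).map fun E =>
                (index E, ident (gate q E), G.dist q (gate q E))) (by omega)
              ⟨by simp [h1.one], by simp [h1.zero], by simp [h1.width]⟩ ?_ ?_ ?_ ?_).imp ?_) ?_))
          · have := hL.label q
            have a1 : s1 12 = ident q := by
              rw [j3 12 (by omega), i7 12 (by omega) (by omega), h12]
            have a2 : s1 6 = off := by rw [j3 6 (by omega), i7 6 (by omega) (by omega), h6]
            simpa [a1, a2] using this
          · have a2 : s1 6 = off := by rw [j3 6 (by omega), i7 6 (by omega) (by omega), h6]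
            simpa [a2] using hb
          · have a1 : s1 12 = ident q := by
              rw [j3 12 (by omega), i7 12 (by omega) (by omega), h12]
            simpa [a1] using hq
          · simpa using hE
          · rintro s2 ⟨k1, k2⟩
            refine ⟨?_, by simp [k2], by simp [k2], fun r hr => ?_⟩
            · rw [k1, ← hL.mem_lad]
              simp [hL.index_injective.eq_iff]
            · simp [k2 r (by omega), show r ≠ 16 by omega, show r ≠ 15 by omega, j3 r (by omega)]
          rintro s2 ⟨k1, k2, k3, k4⟩
          have h2 := hs'.of_frame (by omega) k4
          refine .cons (T₁ := 1 + (60 * (w + 1) ^ 2 + 3) + 1) (T₂ := 2)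
            (R := fun s3 => (∃ x, s3 13 = ident x ∧
              ladder G v₀ x = ladder G v₀ p ∩ (ladder G v₀ q ∪ {E | E ∈ l}) ∧
              s3 7 + G.dist x q = s 7 + G.dist p q) ∧ s3 14 = l.length + 1 ∧ s3 15 = s' 15 + w ∧
              ∀ r < 13, r ≠ 7 → s3 r = s r)
            (.cond ?_ ?_) fun s3 h3 => .sub l.length ?_ (by omega) (.nil ?_)
          · intro hne
            have hEq := k1.1 hne
            refine .skip ⟨⟨x, by rw [k4 13 (by omega), hx], ?_, by rw [k4 7 (by omega), hdx]⟩,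
              by rw [k4 14 (by omega), i1], k3, fun r hr hr' => by
                rw [k4 r (by omega), i7 r hr hr']⟩
            rw [hlx]
            ext F
            simp only [Set.mem_inter_iff, Set.mem_union, Set.mem_ofPred_eq, List.mem_cons]
            constructor
            · rintro ⟨hF, hF' | rfl | hF'⟩ <;> tauto
            · tauto
          · intro hz
            have hEq : E ∉ ladder G v₀ q := fun h => k1.2 h hz
            have hEx : E ∈ ladder G v₀ x := by
              rw [hlx]
              exact ⟨hEp, .inr (by simp)⟩
            have hgate := hL.isGate x E hEx
            have hgx : ladder G v₀ (gate x E) = ladder G v₀ x \ {E} := hgate.1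
            -- The vertex `q` need not lie in the fiber of the gate; `E ∉ L_q` suffices for the jump
            -- to stay on a shortest path to `q`.
            have hint := hG.gate_mem_interval hEx hgate hEq
            rw [mem_interval] at hint
            have hgl := hL.ident_lt (gate x E)
            have a6 : s2 6 = off := by rw [k4 6 (by omega), i7 6 (by omega) (by omega), h6]
            have a13 : s2 13 = ident x := by rw [k4 13 (by omega), hx]
            refine .cons (T₁ := 60 * (w + 1) ^ 2) (T₂ := 3) (findTriplet_spec (by omega) h2
              (I := (lad x).map index) (by rw [a6, a13]; exact hL.label x) (by rw [a6]; exact hb)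
              (by rw [a13]; exact hL.ident_lt x) (by rw [k2]; exact hE)
              (g := ident (gate x E)) (d := G.dist x (gate x E)) ?_ ?_) ?_
            · rw [k2]
              exact List.mem_map.2 ⟨E, (hL.mem_lad x E).2 hEx, rfl⟩
            · intro t ht htE
              obtain ⟨F, -, rfl⟩ := List.mem_map.1 ht
              rw [k2] at htE ⊢
              rw [hL.index_injective htE]
            · rintro s3 ⟨l1, l2, l3⟩
              have a7 : s3 7 = s' 7 := by rw [l3 7 (by omega), k4 7 (by omega)]
              have h3 := h2.of_frame (by omega) l3
              refine .add (ident (gate x E)) (by simp [l1, h3.zero]) (by omega)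
                (.add (s' 7 + G.dist x (gate x E)) (by simp [a7, l2]) (by omega)
                (.nil ⟨⟨gate x E, by simp, ?_, by simp; omega⟩, ?_, ?_, fun r hr hr' => ?_⟩))
              · rw [hgx, hlx]
                ext F
                simp only [Set.mem_inter_iff, Set.mem_union, Set.mem_ofPred_eq, List.mem_cons,
                  Set.mem_sdiff, Set.mem_singleton_iff]
                have hEl : E ∉ l := (List.nodup_cons.1 i5).1
                constructor
                · tauto
                · rintro ⟨hF, hF'⟩
                  refine ⟨⟨hF, by tauto⟩, ?_⟩
                  rintro rfl
                  tauto
              · simp [l3 14 (by omega), k4 14 (by omega), i1]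
              · simp [l3 15 (by omega), k3]
              · simp [hr', show r ≠ 13 by omega, l3 r (by omega), k4 r (by omega), i7 r hr hr']
          · rw [h3.2.1, h3.2.2.2 3 (by omega) (by omega), hs.one]
            omega
          · obtain ⟨⟨y, hy, hly, hdy⟩, m1, m2, m3⟩ := h3
            refine ⟨⟨y, by simp [hy], hly, by simpa using hdy⟩, by simp, ?_, by simp; omega,
              fun F hF => i4 F (by simp [hF]), (List.nodup_cons.1 i5).2, by omega,
              fun r hr hr' => by simp [show r ≠ 14 by omega, m3 r hr hr']⟩
            simpa [m2] using drop_add_of_drop_eq i2 (length_bits _ _)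
        · nlinarith
      · exact fun s' h => by simpa using h.2.1
      · refine ⟨⟨p, by simp [j13], ?_, by simp [j4]⟩, by simp, by simpa using hl2,
          by simp; omega, fun E hE => hE, hL.nodup p, hlen', fun r hr _ => ?_⟩
        · ext E
          simp only [Set.mem_inter_iff, Set.mem_union, Set.mem_ofPred_eq, hL.mem_lad]
          tauto
        · simp [show r ≠ 15 by omega, show r ≠ 14 by omega, j4 r hr]
      · obtain ⟨⟨x, hx, hlx, hdx⟩, -, -, -, -, -, -, h⟩ := h2
        exact ⟨x, hx, by simpa using hlx, hdx, h⟩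
    · have h1 := Nat.mul_le_mul_right (110 * (w + 1) ^ 2 + 1) hlen
      nlinarith [Nat.zero_le (w ^ 3), Nat.zero_le (w ^ 2)]

end Walk

/-! ### The three kinds of recursion steps -/

section Steps

/-- The query vertices, of identities `[0]` and `[1]`, have no label left: the distance between them
is `0` or `1`, and the main loop ends. -/
def finishStep : Prog := block [const 8 0, sub 9 0 1, sub 10 1 0, add 9 9 10,
  .cond 9 (block [add 7 7 3]) .skip]

/-- Query in a graph with a balanced class: if the query vertices are on different sides, the first
one is replaced with its gate.  The position `[6]` is moved behind the block of the class. -/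
def balancedStep : Prog := block [add 22 6 3, add 22 22 5, probe 9 0 22, probe 10 1 22, sub 11 9 10,
  sub 12 10 9, add 11 11 12, add 22 22 3,
  .cond 11 (block [add 21 0 4, readNumber, add 18 23 4, readNumber, add 7 7 23, add 0 18 4])
    (block [add 22 22 5, add 22 22 5]), add 6 22 4]

/-- Query in a graph without balanced class: both query vertices are moved to a common fiber.  Unless
they reach the median vertex, the position `[6]` is moved behind the block of this fiber. -/
def ladderStep : Prog := block [add 11 0 4, add 12 1 4, walkToCommonFiber, add 0 13 4, add 11 1 4,
  add 12 0 4, walkToCommonFiber, add 1 13 4, probe 9 0 6, sub 9 9 3,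
  .cond 9 .skip (block [add 21 0 4, add 22 6 3, readNumber, add 22 22 5,
    .loop 23 (block [add 22 22 5, add 22 22 5, add 22 22 5, add 22 22 5, sub 23 23 3]),
    add 6 22 4])]

/-- One level of the recursion. -/
def queryStep : Prog := block [probe 9 0 6, probe 10 1 6, sub 11 9 3, sub 12 10 3,
  .cond 11 (.cond 12 finishStep ladderStep)
    (.cond 12 ladderStep (.cond 9 balancedStep ladderStep))]

variable {W w off : ℕ} {labels : ℕ → List Bool} {s : ℕ → ℕ}

theorem finishStep_spec (hs : Constants w s) (h0 : s 0 < 2 ^ w) (h1 : s 1 < 2 ^ w)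
    (hwW : 4 * 2 ^ w ≤ 2 ^ W) (hacc : s 7 + (if s 0 = s 1 then 0 else 1) < 2 ^ W) :
    RunsWithin W labels finishStep s 9 fun s' => s' 8 = 0 ∧
      s' 7 = s 7 + if s 0 = s 1 then 0 else 1 := by
  refine .const (by positivity) (.sub (s 0 - s 1) (by simp) (by omega) (.sub (s 1 - s 0) (by simp)
    (by omega) (.add (s 0 - s 1 + (s 1 - s 0)) (by simp) (by omega) (.cons (T₁ := 4) (T₂ := 1)
    (.cond (T₁ := 2) (T₂ := 1) (fun h => .add (s 7 + 1) (by simp [hs.one])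
      (by
        have hne : s 0 ≠ s 1 := fun h' => by simp [h'] at h
        simpa [hne] using hacc) (.nil ?_))
    fun h => .skip ?_) fun s' h => .nil h))))
  · simp at h ⊢
    omega
  · simp at h ⊢
    omega

theorem length_balancedBlock (w index : ℕ) (side : Bool) (gate dist : ℕ) :
    (balancedBlock w index side gate dist).length = 1 + w + 1 + w + w := by
  simp [balancedBlock, length_bits]
  ring

theorem balancedBlock_append (w index : ℕ) (side : Bool) (gate dist : ℕ) (rest : List Bool) :
    balancedBlock w index side gate dist ++ rest =
      true :: (bits w index ++ (side :: (bits w gate ++ (bits w dist ++ rest)))) := by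
  simp [balancedBlock]

/-- Blocks of a balanced class all have the same length, so both side bits are probed at the same
position, and one shift of the position serves both labels. -/
theorem balancedStep_spec (hW : w + 2 ≤ W) (hs : Constants w s) {i i' gp dp gq dq : ℕ}
    {sp sq : Bool} {rest rest' : List Bool}
    (hp : (labels (s 0)).drop (s 6) = balancedBlock w i sp gp dp ++ rest)
    (hq : (labels (s 1)).drop (s 6) = balancedBlock w i' sq gq dq ++ rest')
    (hb : s 6 + 4 * (w + 1) ^ 2 < 2 ^ W) (h0 : s 0 < 2 ^ w) (hg : gp < 2 ^ w) (hd : dp < 2 ^ w)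
    (hacc : sp ≠ sq → s 7 + dp < 2 ^ W) :
    RunsWithin W labels balancedStep s (14 * w + 30) fun s' => Constants w s' ∧
      s' 0 = (if sp = sq then s 0 else gp) ∧ s' 1 = s 1 ∧ s' 6 = s 6 + (1 + w + 1 + w + w) ∧
      s' 7 = s 7 + (if sp = sq then 0 else dp) ∧ s' 8 = s 8 := by
  have hwW : 4 * 2 ^ w ≤ 2 ^ W := by
    rw [show 4 * 2 ^ w = 2 ^ (w + 2) by ring]
    exact Nat.pow_le_pow_right (by norm_num) hW
  have hw : w < 2 ^ w := Nat.lt_two_pow_self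
  have hbound : 1 + w + 1 + w + w ≤ 4 * (w + 1) ^ 2 := by nlinarith
  rw [balancedBlock_append] at hp hq
  have hp1 := drop_add_of_drop_eq (drop_add_of_drop_eq (m := [true]) hp rfl) (length_bits _ _)
  have hq1 := drop_add_of_drop_eq (drop_add_of_drop_eq (m := [true]) hq rfl) (length_bits _ _)
  have hp2 := drop_add_of_drop_eq (m := [sp]) hp1 rfl
  have hp3 := drop_add_of_drop_eq hp2 (length_bits _ _)
  have bp := bitAt_of_drop_eq hp1
  have bq := bitAt_of_drop_eq hq1
  simp only [List.length_singleton] at bp bq hp2 hp3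
  have b1 := Bool.toNat_le sp
  have b2 := Bool.toNat_le sq
  apply RunsWithin.le
  · refine .add (s 6 + 1) (by simp [hs.one]) (by omega) (.add (s 6 + 1 + w) (by simp [hs.width])
      (by omega) (.probe sp.toNat (by simp [bp]) (by omega) (.probe sq.toNat (by simp [bq])
      (by omega) (.sub (sp.toNat - sq.toNat) (by simp) (by omega) (.sub (sq.toNat - sp.toNat)
      (by simp) (by omega) (.add (sp.toNat - sq.toNat + (sq.toNat - sp.toNat)) (by simp) (by omega)
      (.add (s 6 + 1 + w + 1) (by simp [hs.one]) (by omega) (.cons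
      (R := fun s' => Constants w s' ∧
        s' 0 = (if sp = sq then s 0 else gp) ∧ s' 1 = s 1 ∧ s' 22 = s 6 + (1 + w + 1 + w + w) ∧
        s' 7 = s 7 + (if sp = sq then 0 else dp) ∧ s' 8 = s 8)
      (T₁ := 7 * w + 4 + (7 * w + 4 + 3 + 1) + 1 + 3 + 1) (T₂ := 2)
      (.cond (T₁ := 7 * w + 4 + (7 * w + 4 + 3 + 1) + 1) (T₂ := 3) ?_ ?_) ?_))))))))
    · intro h
      have hne : sp ≠ sq := by
        rintro rfl
        simp at h
      have := hacc hne
      simp only [if_neg hne]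
      refine .add (s 0) (by simp [hs.zero]) (by omega) (.cons (T₁ := 7 * w + 4)
        (T₂ := 7 * w + 4 + 3 + 1) (readNumber_spec (x := gp) (rest := bits w dp ++ rest) (by omega)
        ⟨by simp [hs.one], by simp [hs.zero], by simp [hs.width]⟩ hg (by simpa using hp2)
        (by simp; omega)) ?_)
      rintro s1 ⟨j1, j2, j3⟩
      have j21 := j3 21 (by omega)
      simp at j2 j21
      have j4 : ∀ r < 9, s1 r = s r := fun r hr => by
        simp [j3 r (by omega), show r ≠ 21 by omega, show r ≠ 22 by omega, show r ≠ 9 by omega,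
          show r ≠ 10 by omega, show r ≠ 11 by omega, show r ≠ 12 by omega]
      have h1 := hs.of_frame (by omega) j4
      refine .add gp (by simp [j1, h1.zero]) (by omega) (.cons (T₁ := 7 * w + 4) (T₂ := 3)
        (readNumber_spec (x := dp) (rest := rest) (by omega)
        ⟨by simp [h1.one], by simp [h1.zero], by simp [h1.width]⟩ hd (by simpa [j2, j21] using hp3)
        (by simp; omega)) ?_)
      rintro s2 ⟨k1, k2, k3⟩
      have k18 := k3 18 (by omega)
      simp at k2 k18
      have k4 : ∀ r < 9, s2 r = s r := fun r hr => by
        simp [k3 r (by omega), show r ≠ 18 by omega, j4 r hr]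
      have h2 := hs.of_frame (by omega) k4
      refine .add (s 7 + dp) (by simp [k1, k4]) (by omega) (.add gp (by simp [k18, h2.zero])
        (by omega) (.nil ⟨⟨by simp [h2.one], by simp [h2.zero], by simp [h2.width]⟩, by simp,
        by simp [k4], by simp; omega, by simp, by simp [k4]⟩))
    · intro h
      have heq : sp = sq := by
        revert h
        cases sp <;> cases sq <;> simp
      subst heq
      refine .add (s 6 + 1 + w + 1 + w) (by simp [hs.width]) (by omega) (.add
        (s 6 + 1 + w + 1 + w + w) (by simp [hs.width]) (by omega) (.nil ⟨⟨by simp [hs.one],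
        by simp [hs.zero], by simp [hs.width]⟩, by simp, by simp, by simp; omega, by simp,
        by simp⟩))
    · rintro s1 ⟨j1, j2, j3, j4, j5, j6⟩
      refine .add (s 6 + (1 + w + 1 + w + w)) (by simp [j4, j1.zero]) (by omega) (.nil
        ⟨⟨by simp [j1.one], by simp [j1.zero], by simp [j1.width]⟩, by simp [j2], by simp [j3],
        by simp, by simp [j5], by simp [j6]⟩)
  · omega

variable {V : Type*} {G : SimpleGraph V} {v₀ : V}
  {ident : V → ℕ} {index : ThetaClass G → ℕ} {lad : V → List (ThetaClass G)}
  {gate : V → ThetaClass G → V}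

/-- The first walk takes `p` towards `q` and ends at `x`; the second takes `q` towards `x` and ends
at `y` with ladder set `L_q ∩ L_x = L_p ∩ L_q`. If `x` has no label left, the position is not moved.
-/
theorem ladderStep_spec (hG : IsMedianGraph G)
    (hL : IsLadderLevel w labels off G v₀ ident index lad gate) (hW : w + 2 ≤ W)
    (hs : Constants w s) {p q : V} (h0 : s 0 = ident p) (h1 : s 1 = ident q) (h6 : s 6 = off)
    (hb : off + 4 * (w + 1) ^ 2 < 2 ^ W) (hacc : s 7 + G.dist p q < 2 ^ W) :
    RunsWithin W labels ladderStep s (320 * (w + 1) ^ 3) fun s' => ∃ x y : V, Constants w s' ∧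
      s' 0 = ident x ∧ s' 1 = ident y ∧ ladder G v₀ x = ladder G v₀ p ∩ ladder G v₀ q ∧
      ladder G v₀ y = ladder G v₀ p ∩ ladder G v₀ q ∧
      s' 7 + G.dist x y = s 7 + G.dist p q ∧ s' 8 = s 8 ∧
      s' 6 = off + if (labels (ident x)).drop off = [] then 0 else
        1 + w + (lad x).length * w + w + (lad x).length * (3 * w) := by
  have hwW : 4 * 2 ^ w ≤ 2 ^ W := by
    rw [show 4 * 2 ^ w = 2 ^ (w + 2) by ring]
    exact Nat.pow_le_pow_right (by norm_num) hW
  have hw : w < 2 ^ w := Nat.lt_two_pow_self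
  have hp := hL.ident_lt p
  have hq := hL.ident_lt q
  apply RunsWithin.le
  · refine .add (ident p) (by simp [h0, hs.zero]) (by omega) (.add (ident q)
      (by simp [h1, hs.zero]) (by omega) (.cons (T₁ := 140 * (w + 1) ^ 3)
      (T₂ := 140 * (w + 1) ^ 3 + (1 + (7 * w + 4 + (w * 7 + 1 + 2 + 1) + 1 + 1) + 1 + 1 + 3) + 3)
      (R := fun s' => ∃ x : V, s' 13 = ident x ∧
        ladder G v₀ x = ladder G v₀ p ∩ ladder G v₀ q ∧
        s' 7 + G.dist x q = s 7 + G.dist p q ∧ ∀ r < 11, r ≠ 7 → s' r = s r)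
      ((walkToCommonFiber_spec (p := p) (q := q) hG hL hW ⟨by simp [hs.one], by simp [hs.zero],
        by simp [hs.width]⟩ (by simp) (by simp) (by simp [h6]) hb (by simpa using hacc)).imp
        ?_) ?_))
    · rintro s1 ⟨x, j1, j2, j3, j4⟩
      refine ⟨x, j1, j2, by simpa using j3, fun r hr hr' => ?_⟩
      simp [j4 r (by omega) hr', show r ≠ 11 by omega, show r ≠ 12 by omega]
    rintro s1 ⟨x, j1, j2, j3, j4⟩
    have hx := hL.ident_lt x
    have hs1 : Constants w s1 := ⟨by rw [j4 3 (by omega) (by omega), hs.one],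
      by rw [j4 4 (by omega) (by omega), hs.zero], by rw [j4 5 (by omega) (by omega), hs.width]⟩
    have a1 := j4 1 (by omega) (by omega)
    have a6 := j4 6 (by omega) (by omega)
    have a8 := j4 8 (by omega) (by omega)
    refine .add (ident x) (by simp [j1, hs1.zero]) (by omega) (.add (ident q)
      (by simp [a1, h1, hs1.zero]) (by omega) (.add (ident x) (by simp [hs1.zero]) (by omega)
      (.cons (T₁ := 140 * (w + 1) ^ 3)
      (T₂ := 1 + (7 * w + 4 + (w * 7 + 1 + 2 + 1) + 1 + 1) + 1 + 1 + 3)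
      (R := fun s' => ∃ y : V, s' 13 = ident y ∧
        ladder G v₀ y = ladder G v₀ p ∩ ladder G v₀ q ∧
        s' 7 + G.dist x y = s 7 + G.dist p q ∧ Constants w s' ∧ s' 0 = ident x ∧ s' 6 = off ∧
        s' 8 = s 8)
      ((walkToCommonFiber_spec (p := q) (q := x) hG hL hW ⟨by simp [hs1.one], by simp [hs1.zero],
        by simp [hs1.width]⟩ (by simp) (by simp) (by simp [a6, h6]) hb
        (by rw [G.dist_comm]; simp; omega)).imp ?_) ?_)))
    · rintro s2 ⟨y, k1, k2, k3, k4⟩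
      refine ⟨y, k1, ?_, ?_, ?_, ?_, ?_, ?_⟩
      · rw [k2, j2]
        ext E
        simp only [Set.mem_inter_iff]
        tauto
      · simp at k3
        rw [G.dist_comm (u := y), G.dist_comm (u := q)] at k3
        omega
      · exact ⟨by simp [k4, hs1.one], by simp [k4, hs1.zero], by simp [k4, hs1.width]⟩
      · simp [k4]
      · simp [k4, a6, h6]
      · simp [k4, a8]
    rintro s2 ⟨y, k1, k2, k3, k4, k5, k6, k7⟩
    have hy := hL.ident_lt y
    have hlx := hL.label x
    rcases hlx.shape with ⟨hnil, -⟩ | ⟨d, rest, hshape⟩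
    · have hbit := bitAt_of_drop_eq_nil hnil
      refine .add (ident y) (by simp [k1, k4.zero]) (by omega) (.probe 2 (by simp [k5, k6, hbit])
        (by omega) (.sub 1 (by simp [k4.one]) (by omega) (.cons
        (T₁ := 1 + (7 * w + 4 + (w * 7 + 1 + 2 + 1) + 1 + 1) + 1) (T₂ := 1)
        ((RunsWithin.cond_true (by simp) (.skip ?_)).le (by omega)) fun s' h => .nil h)))
      exact ⟨x, y, ⟨by simp [k4.one], by simp [k4.zero], by simp [k4.width]⟩, by simp [k5], by simp,
        j2, k2, by simpa using k3, by simp [k7], by simp [k6, hnil]⟩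
    · have hlen := hlx.length_le
      rw [List.length_map] at hlen
      have hbound := block_length_bound hlen
      rw [unbalancedBlock_append, List.length_map] at hshape
      have hbit := bitAt_of_drop_eq hshape
      have hl1 := drop_add_of_drop_eq (m := [false]) hshape rfl
      refine .add (ident y) (by simp [k1, k4.zero]) (by omega) (.probe 0 (by simp [k5, k6, hbit])
        (by omega) (.sub 0 (by simp) (by omega) (.cons
        (T₁ := 1 + (7 * w + 4 + (w * 7 + 1 + 2 + 1) + 1 + 1) + 1) (T₂ := 1)
        ((RunsWithin.cond_false (T := 7 * w + 4 + (w * 7 + 1 + 2 + 1) + 1 + 1) (by simp)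
        (.add (ident x) (by simp [k5, k4.zero]) (by omega)
        (.add (off + 1) (by simp [k6, k4.one]) (by omega) (.cons (T₁ := 7 * w + 4)
        (T₂ := w * 7 + 1 + 2 + 1)
        (readNumber_spec (x := (lad x).length) (by omega) ⟨by simp [k4.one], by simp [k4.zero],
          by simp [k4.width]⟩ (by omega) (by simpa using hl1) (by simp; omega)) ?_)))).le
          (by omega)) fun s' h => .nil h)))
      rintro s3 ⟨l1, l2, l3⟩
      simp at l2
      have l4 : ∀ r < 9, r ≠ 1 → s3 r = s2 r := fun r hr hr' => by
        simp [l3 r (by omega), show r ≠ 22 by omega, show r ≠ 21 by omega, show r ≠ 9 by omega, hr']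
      have l31 := l3 1 (by omega)
      simp at l31
      have h3 : Constants w s3 := ⟨by rw [l4 3 (by omega) (by omega), k4.one],
        by rw [l4 4 (by omega) (by omega), k4.zero], by rw [l4 5 (by omega) (by omega), k4.width]⟩
      -- Each ladder class accounts for `4 * w` bits: `w` for its index in the list and `3 * w` for
      -- its triplet.
      have hfin : off + 1 + w + w + (lad x).length * (4 * w) =
          off + (1 + w + (lad x).length * w + w + (lad x).length * (3 * w)) := by ring
      refine .add (off + 1 + w + w) (by simp [l2, h3.width]) (by omega) (.cons
        (T₁ := w * 7 + 1) (T₂ := 2)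
        ((RunsWithin.loop_count (T := 6) (fun k s' => s' 23 = k ∧ k ≤ w ∧
          s' 22 + k * (4 * w) = off + 1 + w + w + (lad x).length * (4 * w) ∧
          ∀ r < 9, s' r = s3 r) ?_ ?_ (lad x).length ?_).le ?_) fun s4 h4 =>
        .add (off + (1 + w + (lad x).length * w + w + (lad x).length * (3 * w))) ?_ (by omega)
          (.nil ?_))
      · rintro k s' ⟨m1, m2, m3, m4⟩
        have h' := h3.of_frame (by omega) m4
        rw [Nat.succ_mul] at m3
        refine ⟨by omega, .add (s' 22 + w) (by simp [h'.width]) (by omega) (.add (s' 22 + w + w)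
          (by simp [h'.width]) (by omega) (.add (s' 22 + w + w + w) (by simp [h'.width]) (by omega)
          (.add (s' 22 + w + w + w + w) (by simp [h'.width]) (by omega) (.sub k (by
          simp [m1, h'.one]) (by omega) (.nil ⟨by simp, by omega, by simp; omega,
          fun r hr => ?_⟩)))))⟩
        simp [show r ≠ 22 by omega, show r ≠ 23 by omega, m4 r hr]
      · exact fun s' h => h.1
      · refine ⟨by simp [l1], hlen, by simp, fun r hr => ?_⟩
        simp [show r ≠ 22 by omega]
      · have := Nat.mul_le_mul_right 7 hlen
        omega
      · obtain ⟨-, -, m3, m4⟩ := h4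
        rw [m4 4 (by omega), h3.zero]
        omega
      · obtain ⟨-, -, m3, m4⟩ := h4
        have h4 := h3.of_frame (by omega) m4
        refine ⟨x, y, ⟨by simp [h4.one], by simp [h4.zero], by simp [h4.width]⟩,
          by simp [m4, l4, k5], by simp [m4, l31], j2, k2, by simpa [m4, l4] using k3,
          by simp [m4, l4, k7], ?_⟩
        rw [if_neg (by rw [hshape]; simp)]
        simp
  · nlinarith [Nat.zero_le (w ^ 3), Nat.zero_le (w ^ 2)]

end Steps

/-! ### Correctness of the main loop -/

section Query

variable {W w off : ℕ} {labels : ℕ → List Bool} {s : ℕ → ℕ}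

/-- The number of steps of one level of the recursion. -/
def stepTime (w : ℕ) : ℕ := 340 * (w + 1) ^ 3

theorem queryStep_finish (hW : w + 2 ≤ W) (hs : Constants w s) (h0 : s 0 < 2 ^ w) (h1 : s 1 < 2 ^ w)
    (hp : (labels (s 0)).drop (s 6) = []) (hq : (labels (s 1)).drop (s 6) = [])
    (hacc : s 7 + (if s 0 = s 1 then 0 else 1) < 2 ^ W) :
    RunsWithin W labels queryStep s (stepTime w) fun s' => s' 8 = 0 ∧
      s' 7 = s 7 + if s 0 = s 1 then 0 else 1 := by
  have hwW : 4 * 2 ^ w ≤ 2 ^ W := by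
    rw [show 4 * 2 ^ w = 2 ^ (w + 2) by ring]
    exact Nat.pow_le_pow_right (by norm_num) hW
  have bp := bitAt_of_drop_eq_nil hp
  have bq := bitAt_of_drop_eq_nil hq
  apply RunsWithin.le
  · refine .probe 2 (by simp [bp]) (by omega) (.probe 2 (by simp [bq]) (by omega)
      (.sub 1 (by simp [hs.one]) (by omega) (.sub 1 (by simp [hs.one]) (by omega)
      (.cons (T₁ := 9 + 1 + 1) (T₂ := 1) (.cond_true (by simp) (.cond_true (by simp)
      ((finishStep_spec ⟨by simp [hs.one], by simp [hs.zero], by simp [hs.width]⟩ (by simpa using h0)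
        (by simpa using h1) hwW (by simpa using hacc)).imp fun s' h => by simpa using h)))
      fun s' h => .nil h))))
  · rw [stepTime]
    have := Nat.one_le_pow 3 (w + 1) (by omega)
    omega

theorem queryStep_balanced (hW : w + 2 ≤ W) (hs : Constants w s) {i i' gp dp gq dq : ℕ}
    {sp sq : Bool} {rest rest' : List Bool}
    (hp : (labels (s 0)).drop (s 6) = balancedBlock w i sp gp dp ++ rest)
    (hq : (labels (s 1)).drop (s 6) = balancedBlock w i' sq gq dq ++ rest')
    (hb : s 6 + 4 * (w + 1) ^ 2 < 2 ^ W) (h0 : s 0 < 2 ^ w) (hg : gp < 2 ^ w) (hd : dp < 2 ^ w)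
    (hacc : sp ≠ sq → s 7 + dp < 2 ^ W) :
    RunsWithin W labels queryStep s (stepTime w) fun s' => Constants w s' ∧
      s' 0 = (if sp = sq then s 0 else gp) ∧ s' 1 = s 1 ∧ s' 6 = s 6 + (1 + w + 1 + w + w) ∧
      s' 7 = s 7 + (if sp = sq then 0 else dp) ∧ s' 8 = s 8 := by
  have hwW : 4 * 2 ^ w ≤ 2 ^ W := by
    rw [show 4 * 2 ^ w = 2 ^ (w + 2) by ring]
    exact Nat.pow_le_pow_right (by norm_num) hW
  have bp := bitAt_of_drop_eq ((balancedBlock_append ..) ▸ hp)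
  have bq := bitAt_of_drop_eq ((balancedBlock_append ..) ▸ hq)
  apply RunsWithin.le
  · refine .probe 1 (by simp [bp]) (by omega) (.probe 1 (by simp [bq]) (by omega)
      (.sub 0 (by simp [hs.one]) (by omega) (.sub 0 (by simp [hs.one]) (by omega)
      (.cons (T₁ := 14 * w + 30 + 1 + 1 + 1) (T₂ := 1) (.cond_false (by simp) (.cond_false (by simp)
      (.cond_true (by simp) ((balancedStep_spec hW ⟨by simp [hs.one], by simp [hs.zero],
        by simp [hs.width]⟩ (by simpa using hp) (by simpa using hq) (by simpa using hb)
        (by simpa using h0) hg hd (by simpa using hacc)).imp ?_)))) fun s' h => .nil h))))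
    rintro s' ⟨j1, j2, j3, j4, j5, j6⟩
    exact ⟨j1, by simpa using j2, by simpa using j3, by simpa using j4, by simpa using j5,
      by simpa using j6⟩
  · rw [stepTime]
    nlinarith [Nat.zero_le (w ^ 3), Nat.zero_le (w ^ 2)]

section Ladder

variable {V : Type*} {G : SimpleGraph V} {v₀ : V}
  {ident : V → ℕ} {index : ThetaClass G → ℕ} {lad : V → List (ThetaClass G)}
  {gate : V → ThetaClass G → V}

theorem IsLadderLevel.bitAt_eq (hL : IsLadderLevel w labels off G v₀ ident index lad gate) (x : V) :
    bitAt (labels (ident x)) off = if (labels (ident x)).drop off = [] then 2 else 0 := by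
  rcases (hL.label x).shape with ⟨h, -⟩ | ⟨d, rest, h⟩
  · rw [if_pos h, bitAt_of_drop_eq_nil h]
  · rw [unbalancedBlock_append] at h
    rw [bitAt_of_drop_eq h, h]
    simp

/-- One of the two labels may be empty, when that vertex is `v₀`; the other one still shows that a
ladder step is due. -/
theorem queryStep_ladder (hG : IsMedianGraph G)
    (hL : IsLadderLevel w labels off G v₀ ident index lad gate) (hW : w + 2 ≤ W)
    (hs : Constants w s) {p q : V} (h0 : s 0 = ident p) (h1 : s 1 = ident q) (h6 : s 6 = off)
    (hb : off + 4 * (w + 1) ^ 2 < 2 ^ W) (hacc : s 7 + G.dist p q < 2 ^ W)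
    (hpq : ¬ ((labels (ident p)).drop off = [] ∧ (labels (ident q)).drop off = [])) :
    RunsWithin W labels queryStep s (stepTime w) fun s' => ∃ x y : V, Constants w s' ∧
      s' 0 = ident x ∧ s' 1 = ident y ∧ ladder G v₀ x = ladder G v₀ p ∩ ladder G v₀ q ∧
      ladder G v₀ y = ladder G v₀ p ∩ ladder G v₀ q ∧
      s' 7 + G.dist x y = s 7 + G.dist p q ∧ s' 8 = s 8 ∧
      s' 6 = off + if (labels (ident x)).drop off = [] then 0 else
        1 + w + (lad x).length * w + w + (lad x).length * (3 * w) := by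
  have hwW : 4 * 2 ^ w ≤ 2 ^ W := by
    rw [show 4 * 2 ^ w = 2 ^ (w + 2) by ring]
    exact Nat.pow_le_pow_right (by norm_num) hW
  have hpos := Nat.one_le_two_pow (n := w)
  have bp := hL.bitAt_eq p
  have bq := hL.bitAt_eq q
  set P := (labels (ident p)).drop off = []
  set Q := (labels (ident q)).drop off = []
  apply RunsWithin.le
  · refine .probe (if P then 2 else 0) (by rw [h0, h6, bp]) (by omega)
      (.probe (if Q then 2 else 0) (by
        rw [Function.update_of_ne (by decide), Function.update_of_ne (by decide), h1, h6, bq])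
        (by omega)
      (.sub (if P then 1 else 0) (by by_cases h : P <;> simp [h, hs.one])
        (by by_cases h : P <;> simp [h]; omega)
      (.sub (if Q then 1 else 0) (by by_cases h : Q <;> simp [h, hs.one])
        (by by_cases h : Q <;> simp [h]; omega)
      (.cons (T₁ := 320 * (w + 1) ^ 3 + 10) (T₂ := 1) ?_ fun s' h => .nil h))))
    set s1 := Function.update (Function.update (Function.update (Function.update s 9
      (if P then 2 else 0)) 10 (if Q then 2 else 0)) 11 (if P then 1 else 0)) 12
      (if Q then 1 else 0) with hs1
    have e : ∀ r < 9, s1 r = s r := fun r hr => by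
      simp [hs1, show r ≠ 9 by omega, show r ≠ 10 by omega, show r ≠ 11 by omega,
        show r ≠ 12 by omega]
    have key := ladderStep_spec hG hL hW (hs.of_frame (by omega) e) (p := p) (q := q)
      (by rw [e 0 (by omega), h0]) (by rw [e 1 (by omega), h1]) (by rw [e 6 (by omega), h6]) hb
      (by rw [e 7 (by omega)]; exact hacc)
    rw [e 7 (by omega), e 8 (by omega)] at key
    by_cases hP : P
    · have hQ : ¬ Q := fun h => hpq ⟨hP, h⟩
      exact (RunsWithin.cond_true (by simp [hs1, hP]) (.cond_false (by simp [hs1, hQ]) key)).le (by omega)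
    · by_cases hQ : Q
      · exact (RunsWithin.cond_false (by simp [hs1, hP]) (.cond_true (by simp [hs1, hQ]) key)).le (by omega)
      · exact (RunsWithin.cond_false (by simp [hs1, hP]) (.cond_false (by simp [hs1, hQ])
          (.cond_false (by simp [hs1, hP]) key))).le (by omega)
  · rw [stepTime]
    have := Nat.one_le_pow 3 (w + 1) (by omega)
    omega

end Ladder

/-- The main loop, started at position `off` of the labels, computes the distances in `G` within
`k + 2` iterations if `G` has at most `(3 / 2) ^ k` vertices. -/
def ComputesDist (W w : ℕ) (labels : ℕ → List Bool) {V : Type u} (G : SimpleGraph V)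
    (ident : V → ℕ) (Λ : V → List Bool) : Prop :=
  ∀ (k off : ℕ) (s : ℕ → ℕ) (p q : V), Nat.card V * 2 ^ k ≤ 3 ^ k →
    (∀ x, (labels (ident x)).drop off = Λ x) → Constants w s → s 0 = ident p → s 1 = ident q →
    s 6 = off → s 8 ≠ 0 → off + (k + 1) * (4 * (w + 1) ^ 2) < 2 ^ W → s 7 + G.dist p q < 2 ^ W →
    RunsWithin W labels (.loop 8 queryStep) s ((k + 2) * (stepTime w + 1)) fun s' =>
      s' 7 = s 7 + G.dist p q

theorem dist_lt_card {V : Type*} [Finite V] {G : SimpleGraph V} (hG : G.Connected) (x y : V) :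
    G.dist x y < Nat.card V := by
  have := Fintype.ofFinite V
  obtain ⟨p, hp, hlen⟩ := hG.exists_path_of_dist x y
  rw [← hlen, Nat.card_eq_fintype_card]
  exact hp.length_lt

/-- Shrinking the vertex set by a factor `2/3` uses up one unit of the level budget `k`. -/
theorem card_mul_le_of_three_mul_le {m n k : ℕ} (h : 3 * m ≤ 2 * n)
    (hn : n * 2 ^ (k + 1) ≤ 3 ^ (k + 1)) : m * 2 ^ k ≤ 3 ^ k := by
  have := Nat.mul_le_mul_right (2 ^ k) h
  rw [pow_succ, pow_succ] at hn
  nlinarith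

theorem card_le_two_pow {V : Type*} [Finite V] {ident : V → ℕ} (hinj : Function.Injective ident)
    (hlt : ∀ x, ident x < 2 ^ w) : Nat.card V ≤ 2 ^ w := by
  have : Function.Injective fun x => (⟨ident x, hlt x⟩ : Fin (2 ^ w)) := fun x y h =>
    hinj (Fin.mk.inj h)
  simpa using Nat.card_le_card_of_injective _ this

/-- The last iteration; the extra step is the failing loop test. -/
theorem runsWithin_loop_finish (hW : w + 2 ≤ W) (hs : Constants w s) (h0 : s 0 < 2 ^ w)
    (h1 : s 1 < 2 ^ w) (hp : (labels (s 0)).drop (s 6) = []) (hq : (labels (s 1)).drop (s 6) = [])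
    (hacc : s 7 + (if s 0 = s 1 then 0 else 1) < 2 ^ W) (h8 : s 8 ≠ 0) :
    RunsWithin W labels (.loop 8 queryStep) s (stepTime w + 1 + 1) fun s' =>
      s' 7 = s 7 + if s 0 = s 1 then 0 else 1 :=
  .loop_true h8 (queryStep_finish hW hs h0 h1 hp hq hacc) fun _ h => .loop_false h.1 h.2

theorem computesDist_small (hW : w + 2 ≤ W) {V : Type u} [Finite V] {G : SimpleGraph V}
    (hG : IsMedianGraph G) {ident : V → ℕ} (hinj : Function.Injective ident)
    (hlt : ∀ x, ident x < 2 ^ w) {Λ : V → List Bool} (hcard : Nat.card V ≤ 2)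
    (hΛ : ∀ x, Λ x = []) : ComputesDist W w labels G ident Λ := by
  intro k off s p q _ hlab hs h0 h1 h6 h8 _ hacc
  have hd : G.dist p q = if s 0 = s 1 then 0 else 1 := by
    rw [h0, h1]
    have := dist_lt_card hG.connected p q
    split_ifs with h
    · rw [hinj h, G.dist_self]
    · have := hG.connected.pos_dist_of_ne fun h' : p = q => h (by rw [h'])
      omega
  rw [hd] at hacc ⊢
  refine (runsWithin_loop_finish hW hs (h0 ▸ hlt p) (h1 ▸ hlt q) ?_ ?_ hacc h8).le ?_
  · rw [h0, h6, hlab, hΛ]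
  · rw [h1, h6, hlab, hΛ]
  · nlinarith

/-- Each side has at least `n/3` vertices, so each has at most `2n/3`. If `p` and `q` are on
different sides, the gate of `p` is on the side of `q` and on a shortest path from `p` to `q`. -/
theorem computesDist_balanced (hW : w + 2 ≤ W) {V : Type u} [Finite V] {G : SimpleGraph V}
    (hG : IsMedianGraph G) {ident : V → ℕ}
    (hlt : ∀ x, ident x < 2 ^ w) (hcardw : Nat.card V ≤ 2 ^ w) {Λ : V → List Bool}
    (hcard : 3 ≤ Nat.card V) {i : ℕ} {E : ThetaClass G} (hE : E.IsBalanced) {H₁ H₂ : Set V}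
    (half₁ : E.IsHalfspace H₁) (half₂ : E.IsHalfspace H₂) (hcompl : H₂ = H₁ᶜ) {gate : V → V}
    (gate₁ : ∀ x ∈ H₁, IsGate G H₂ x (gate x)) (gate₂ : ∀ x ∈ H₂, IsGate G H₁ x (gate x))
    {Λ₁ : H₁ → List Bool} {Λ₂ : H₂ → List Bool}
    (ih₁ : IsMedianGraph (G.induce H₁) →
      ComputesDist W w labels (G.induce H₁) (fun x => ident x) Λ₁)
    (ih₂ : IsMedianGraph (G.induce H₂) →
      ComputesDist W w labels (G.induce H₂) (fun x => ident x) Λ₂)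
    (label₁ : ∀ (x : V) (hx : x ∈ H₁), Λ x =
      balancedBlock w i false (ident (gate x)) (G.dist x (gate x)) ++ Λ₁ ⟨x, hx⟩)
    (label₂ : ∀ (x : V) (hx : x ∈ H₂), Λ x =
      balancedBlock w i true (ident (gate x)) (G.dist x (gate x)) ++ Λ₂ ⟨x, hx⟩) :
    ComputesDist W w labels G ident Λ := by
  intro k off s p q hk hlab hs h0 h1 h6 h8 hoff hacc
  obtain _ | k := k
  -- A budget `k = 0` would mean at most one vertex.
  · simp at hk
    omega
  have hconv : ∀ H, E.IsHalfspace H → IsConvex G H ∧ H.Nonempty := fun H hH => by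
    obtain ⟨a, b, hab, rfl⟩ := exists_thetaOf_eq E
    rcases (hG.isHalfspace_iff hab).1 hH with rfl | rfl
    · exact ⟨hG.isConvex_nearer hab, a, left_mem_nearer hab⟩
    · exact ⟨hG.isConvex_nearer hab.symm, b, left_mem_nearer hab.symm⟩
  obtain ⟨conv₁, ne₁⟩ := hconv _ half₁
  obtain ⟨conv₂, ne₂⟩ := hconv _ half₂
  have hb1 := hE _ half₁
  have hb2 := hE _ half₂
  have hsum := Set.ncard_add_ncard_compl H₁
  rw [← hcompl] at hsum
  have hbnd : 1 + w + 1 + w + w ≤ 4 * (w + 1) ^ 2 := by nlinarith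
  have hoff' : off + (1 + w + 1 + w + w) + (k + 1) * (4 * (w + 1) ^ 2) < 2 ^ W := by
    rw [Nat.succ_mul (k + 1)] at hoff
    omega
  have descend : ∀ (H : Set V) (ΛH : H → List Bool) (b : Bool), IsConvex G H →
      3 * H.ncard ≤ 2 * Nat.card V →
      ComputesDist W w labels (G.induce H) (fun x => ident x) ΛH →
      (∀ (x : V) (hx : x ∈ H), Λ x =
        balancedBlock w i b (ident (gate x)) (G.dist x (gate x)) ++ ΛH ⟨x, hx⟩) →
      ∀ (s' : ℕ → ℕ) (x y : V), x ∈ H → y ∈ H → Constants w s' → s' 0 = ident x → s' 1 = ident y →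
        s' 6 = off + (1 + w + 1 + w + w) → s' 8 = s 8 → s' 7 + G.dist x y = s 7 + G.dist p q →
        RunsWithin W labels (.loop 8 queryStep) s' ((k + 2) * (stepTime w + 1)) fun s'' =>
          s'' 7 = s 7 + G.dist p q := by
    intro H ΛH b hH hcardH ih hlabH s' x y hx hy hs' g0 g1 g6 g8 hd
    have hdist : (G.induce H).dist ⟨x, hx⟩ ⟨y, hy⟩ = G.dist x y := hH.induce_dist_eq hG.connected _ _
    refine (ih k (off + (1 + w + 1 + w + w)) s' ⟨x, hx⟩ ⟨y, hy⟩
      (card_mul_le_of_three_mul_le hcardH hk) (fun z => ?_) hs' g0 g1 g6 (g8 ▸ h8) hoff'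
      (by rw [hdist]; omega)).imp fun s'' h => by rw [h, hdist, hd]
    have := hlab z
    rw [hlabH z z.2] at this
    exact drop_add_of_drop_eq this (length_balancedBlock ..)
  have h6' : s 6 + 4 * (w + 1) ^ 2 < 2 ^ W := by
    rw [Nat.succ_mul (k + 1)] at hoff
    omega
  have hgd : G.dist p (gate p) < 2 ^ w := (dist_lt_card hG.connected _ _).trans_le hcardw
  have lp := hlab p
  have lq := hlab q
  rw [← h0, ← h6] at lp
  rw [← h1, ← h6] at lq
  have time : stepTime w + 1 + (k + 2) * (stepTime w + 1) ≤ (k + 1 + 2) * (stepTime w + 1) :=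
    le_of_eq (by ring)
  have p0 : s 0 < 2 ^ w := h0 ▸ hlt p
  by_cases hp : p ∈ H₁
  · rw [label₁ p hp] at lp
    by_cases hq : q ∈ H₁
    · rw [label₁ q hq] at lq
      refine (RunsWithin.loop_true h8 (queryStep_balanced hW hs lp lq h6' p0 (hlt _) hgd (by simp))
        fun s' ⟨j1, j2, j3, j4, j5, j6⟩ => ?_).le time
      exact descend H₁ Λ₁ false conv₁ (by omega) (ih₁ (conv₁.induce_isMedianGraph hG ne₁)) label₁
        s' p q hp hq j1 (by simpa [h0] using j2) (j3.trans h1) (h6 ▸ j4) j6 (by simp [j5])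
    · have hq' : q ∈ H₂ := hcompl ▸ hq
      rw [label₂ q hq'] at lq
      have hg := gate₁ p hp
      have hint := hg.2 q hq'
      rw [mem_interval] at hint
      refine (RunsWithin.loop_true h8 (queryStep_balanced hW hs lp lq h6' p0 (hlt _) hgd
        fun _ => by omega) fun s' ⟨j1, j2, j3, j4, j5, j6⟩ => ?_).le time
      exact descend H₂ Λ₂ true conv₂ (by omega) (ih₂ (conv₂.induce_isMedianGraph hG ne₂)) label₂
        s' (gate p) q hg.1 hq' j1 (by simpa using j2) (j3.trans h1) (h6 ▸ j4) j6
        (by simp at j5; omega)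
  · have hp' : p ∈ H₂ := hcompl ▸ hp
    rw [label₂ p hp'] at lp
    by_cases hq : q ∈ H₁
    · rw [label₁ q hq] at lq
      have hg := gate₂ p hp'
      have hint := hg.2 q hq
      rw [mem_interval] at hint
      refine (RunsWithin.loop_true h8 (queryStep_balanced hW hs lp lq h6' p0 (hlt _) hgd
        fun _ => by omega) fun s' ⟨j1, j2, j3, j4, j5, j6⟩ => ?_).le time
      exact descend H₁ Λ₁ false conv₁ (by omega) (ih₁ (conv₁.induce_isMedianGraph hG ne₁)) label₁
        s' (gate p) q hg.1 hq j1 (by simpa using j2) (j3.trans h1) (h6 ▸ j4) j6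
        (by simp at j5; omega)
    · have hq' : q ∈ H₂ := hcompl ▸ hq
      rw [label₂ q hq'] at lq
      refine (RunsWithin.loop_true h8 (queryStep_balanced hW hs lp lq h6' p0 (hlt _) hgd (by simp))
        fun s' ⟨j1, j2, j3, j4, j5, j6⟩ => ?_).le time
      exact descend H₂ Λ₂ true conv₂ (by omega) (ih₂ (conv₂.induce_isMedianGraph hG ne₂)) label₂
        s' p q hp' hq' j1 (by simpa [h0] using j2) (j3.trans h1) (h6 ▸ j4) j6 (by simp [j5])

/-- After the ladder step both vertices are `v₀`, and the next iteration finds two empty labels and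
stops, or they share a fiber of at most half the size, to which the induction hypothesis applies. -/
theorem computesDist_unbalanced (hW : w + 2 ≤ W) {V : Type u} [Finite V] {G : SimpleGraph V}
    (hG : IsMedianGraph G) {ident : V → ℕ} (hinj : Function.Injective ident)
    (hlt : ∀ x, ident x < 2 ^ w) {Λ : V → List Bool}
    (hcard : 3 ≤ Nat.card V) (index : ThetaClass G ≃ Fin (Nat.card (ThetaClass G)))
    {v₀ : V} (hv₀ : IsMedianVertex G v₀)
    {lad : V → List (ThetaClass G)} (lad_nodup : ∀ x, (lad x).Nodup)
    (mem_lad : ∀ x E, E ∈ lad x ↔ E ∈ ladder G v₀ x) {gate : V → ThetaClass G → V}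
    (isGate : ∀ x, ∀ E ∈ ladder G v₀ x,
      IsGate G (ladderFiber G v₀ (ladder G v₀ x \ {E})) x (gate x E))
    {Λr : (L : Set (ThetaClass G)) → ladderFiber G v₀ L → List Bool}
    (ih : ∀ L : Set (ThetaClass G), L.Nonempty → IsMedianGraph (G.induce (ladderFiber G v₀ L)) →
      ComputesDist W w labels (G.induce (ladderFiber G v₀ L)) (fun x => ident x) (Λr L))
    (label_v₀ : Λ v₀ = [])
    (label : ∀ x : V, x ≠ v₀ → Λ x =
      unbalancedBlock w ((lad x).map fun E => (index E : ℕ)) (G.dist v₀ x)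
        ((lad x).map fun E => ((index E : ℕ), ident (gate x E), G.dist x (gate x E))) ++
      Λr (ladder G v₀ x) ⟨x, rfl⟩) :
    ComputesDist W w labels G ident Λ := by
  intro k off s p q hk hlab hs h0 h1 h6 h8 hoff hacc
  have hcardw := card_le_two_pow hinj hlt
  obtain _ | k := k
  · simp at hk
    omega
  have lad_v₀ : lad v₀ = [] := List.eq_nil_iff_forall_not_mem.2 fun E => by
    rw [mem_lad, ladder_self]
    exact id
  have lad_length : ∀ x, (lad x).length = (ladder G v₀ x).ncard := fun x => by
    classical
    rw [← List.toFinset_card_of_nodup (lad_nodup x), ← Set.ncard_coe_finset]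
    congr 1
    ext E
    simp [mem_lad]
  have nil_iff : ∀ x, (labels (ident x)).drop off = [] ↔ x = v₀ := fun x => by
    rw [hlab]
    refine ⟨fun h => ?_, fun h => h ▸ label_v₀⟩
    by_contra hne
    rw [label x hne, unbalancedBlock_append] at h
    exact List.cons_ne_nil _ _ h
  have hL : IsLadderLevel w labels off G v₀ ident (fun E => (index E : ℕ)) lad gate := by
    refine ⟨fun E F h => index.injective (Fin.ext h), lad_nodup, mem_lad, isGate, hlt,
      fun x => ⟨?_, ?_, by simp, ?_, ?_⟩⟩
    · rw [hlab]
      by_cases hx : x = v₀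
      · exact .inl ⟨hx ▸ label_v₀, by rw [hx, lad_v₀, List.map_nil]⟩
      · exact .inr ⟨_, _, label x hx⟩
    · rw [List.length_map, lad_length]
      exact (Nat.pow_le_pow_iff_right (by norm_num)).1
        ((hG.two_pow_ncard_ladder_le x).trans hcardw)
    · intro i hi
      obtain ⟨E, -, rfl⟩ := List.mem_map.1 hi
      exact ((index E).2.trans hG.card_thetaClass_lt).trans_le hcardw
    · intro t ht
      obtain ⟨E, -, rfl⟩ := List.mem_map.1 ht
      exact ⟨((index E).2.trans hG.card_thetaClass_lt).trans_le hcardw, hlt _,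
        (dist_lt_card hG.connected _ _).trans_le hcardw⟩
  have finish : ∀ s' : ℕ → ℕ, Constants w s' → s' 0 = ident v₀ → s' 1 = ident v₀ → s' 6 = off →
      s' 8 ≠ 0 → s' 7 < 2 ^ W →
      RunsWithin W labels (.loop 8 queryStep) s' (stepTime w + 1 + 1) fun s'' => s'' 7 = s' 7 := by
    intro s' hs' g0 g1 g6 g8 g7
    have hnil := (nil_iff v₀).2 rfl
    simpa [g0, g1] using runsWithin_loop_finish hW hs' (g0 ▸ hlt v₀) (g1 ▸ hlt v₀)
      (by rw [g0, g6, hnil]) (by rw [g1, g6, hnil]) (by simpa [g0, g1] using g7) g8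
  by_cases hpq : p = v₀ ∧ q = v₀
  · obtain ⟨rfl, rfl⟩ := hpq
    rw [G.dist_self] at hacc ⊢
    exact (finish s hs h0 h1 h6 h8 hacc).le (by nlinarith)
  rw [Nat.succ_mul (k + 1)] at hoff
  have time : stepTime w + 1 + (k + 2) * (stepTime w + 1) = (k + 1 + 2) * (stepTime w + 1) := by ring
  rw [← time]
  refine RunsWithin.loop_true h8 (queryStep_ladder hG hL hW hs h0 h1 h6 (by omega) hacc
    (by rwa [nil_iff, nil_iff])) ?_
  rintro s' ⟨x, y, j1, j2, j3, hx, hy, j4, j5, j6⟩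
  rcases (ladder G v₀ p ∩ ladder G v₀ q).eq_empty_or_nonempty with hemp | hne
  · rw [hemp] at hx hy
    obtain rfl := hG.eq_of_ladder_eq_empty hx
    obtain rfl := hG.eq_of_ladder_eq_empty hy
    rw [G.dist_self, add_zero] at j4
    rw [if_pos ((nil_iff _).2 rfl), add_zero] at j6
    rw [← j4] at hacc ⊢
    exact (finish s' j1 j2 j3 j6 (j5 ▸ h8) hacc).le (by nlinarith)
  · set L := ladder G v₀ p ∩ ladder G v₀ q
    have ne_v₀ : ∀ z, ladder G v₀ z = L → z ≠ v₀ := by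
      rintro z hz rfl
      rw [← hz, ladder_self] at hne
      exact Set.not_nonempty_empty hne
    rw [if_neg (by rw [nil_iff]; exact ne_v₀ x hx)] at j6
    have hconv := hG.isConvex_ladderFiber (v₀ := v₀) L
    have hdist : (G.induce (ladderFiber G v₀ L)).dist ⟨x, hx⟩ ⟨y, hy⟩ = G.dist x y :=
      hconv.induce_dist_eq hG.connected _ _
    have hc := hG.two_mul_ncard_ladderFiber_le hv₀ hne
    have hlen := (hL.label x).length_le
    rw [List.length_map] at hlen
    have hbound := block_length_bound hlen
    refine (ih L hne (hconv.induce_isMedianGraph hG ⟨x, hx⟩) k _ s' ⟨x, hx⟩ ⟨y, hy⟩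
      (card_mul_le_of_three_mul_le (by omega) hk) (fun z => ?_) j1 j2 j3 j6 (j5 ▸ h8)
      (by omega) (by rw [hdist]; omega)).imp fun s'' h => by rw [h, hdist, j4]
    obtain ⟨z, hz⟩ := z
    have hz' : ladder G v₀ z = L := hz
    -- The label of `z` uses `Λr` at the ladder set of `z`; the dependent argument is transported to
    -- `L`.
    have e : ∀ (L' : Set (ThetaClass G)) (h : ladder G v₀ z = L'),
        Λr (ladder G v₀ z) ⟨z, rfl⟩ = Λr L' ⟨z, h⟩ := by rintro _ rfl; rfl
    have := hlab z
    rw [label z (ne_v₀ z hz'), e L hz'] at this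
    -- All vertices of the fiber have ladder sets of the same size, so the position computed from
    -- the label of `x` is right for every `z`.
    refine drop_add_of_drop_eq this ?_
    rw [length_unbalancedBlock, List.length_map, List.length_map, lad_length, lad_length, hz', hx]

theorem IsLabeling.computesDist (hW : w + 2 ≤ W) {V : Type u} {G : SimpleGraph V} {ident : V → ℕ}
    {Λ : V → List Bool} (h : IsLabeling w G ident Λ) (hfin : Finite V) (hG : IsMedianGraph G)
    (hinj : Function.Injective ident) (hlt : ∀ x, ident x < 2 ^ w) :
    ComputesDist W w labels G ident Λ := by
  induction h with
  | small G ident Λ hcard hΛ => exact computesDist_small hW hG hinj hlt hcard hΛ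
  | balanced G ident Λ hcard index E hE H₁ H₂ half₁ half₂ hcompl gate gate₁ gate₂ Λ₁ Λ₂ _ _
      label₁ label₂ ih₁ ih₂ =>
    exact computesDist_balanced hW hG hlt (card_le_two_pow hinj hlt) hcard hE half₁ half₂ hcompl
      gate₁ gate₂
      (fun h => ih₁ inferInstance h (hinj.comp Subtype.val_injective) fun x => hlt x)
      (fun h => ih₂ inferInstance h (hinj.comp Subtype.val_injective) fun x => hlt x) label₁ label₂
  | unbalanced G ident Λ hcard _ index v₀ hv₀ lad lad_nodup mem_lad gate isGate Λr _ label_v₀ label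
      ih =>
    exact computesDist_unbalanced hW hG hinj hlt hcard index hv₀ lad_nodup mem_lad isGate
      (fun L hL h => ih L hL inferInstance h (hinj.comp Subtype.val_injective) fun x => hlt x)
      label_v₀ label

/-! ### The program -/

/-- Write the length `⌈log₂ [2]⌉` of the numbers in the labels into register `5`. -/
def computeWidth : Prog := block [const 9 1, sub 10 2 9,
  .loop 10 (block [add 9 9 9, add 5 5 3, sub 10 2 9])]

/-- Compute the distance between the vertices of identities `[0]` and `[1]` in a graph with `[2]`
vertices. -/
def distanceQuery : Prog := block [const 3 1, const 8 1, computeWidth, .loop 8 queryStep, const 4 0,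
  add 0 7 4]

theorem computeWidth_spec {n : ℕ} (hn : 1 ≤ n) (hW : Nat.clog 2 n < W) (h2 : s 2 = n) (h3 : s 3 = 1)
    (h5 : s 5 = 0) :
    RunsWithin W labels computeWidth s (5 * Nat.clog 2 n + 4) fun s' => s' 5 = Nat.clog 2 n ∧
      ∀ r < 9, r ≠ 5 → s' r = s r := by
  have hle : n ≤ 2 ^ Nat.clog 2 n := Nat.le_pow_clog (by norm_num) n
  have hlt : 2 ^ Nat.clog 2 n < 2 ^ W := Nat.pow_lt_pow_right (by norm_num) hW
  set w := Nat.clog 2 n with hw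
  have hwlt : w < 2 ^ w := Nat.lt_two_pow_self
  apply RunsWithin.le
  · refine .const (by omega) (.sub (n - 1) (by simp [h2]) (by omega) (.cons
      (T₁ := w * (4 + 1) + 1) (T₂ := 1)
      (RunsWithin.loop_count (T := 4) (fun k s' => s' 5 + k = w ∧ s' 9 = 2 ^ s' 5 ∧
        s' 10 = n - s' 9 ∧ ∀ r < 9, r ≠ 5 → s' r = s r) ?_ ?_ w ?_) fun s' h => .nil ?_))
    -- Register `9` runs through the powers of two; `2 ^ j < n` holds exactly for `j < ⌈log₂ n⌉`,
    -- which fixes the number of iterations.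
    · rintro k s' ⟨i1, i2, i3, i4⟩
      have hj : 2 ^ s' 5 < n := by
        rw [← Nat.lt_clog_iff_pow_lt (by norm_num)]
        omega
      have hle' : 2 ^ (s' 5 + 1) ≤ 2 ^ w := Nat.pow_le_pow_right (by norm_num) (by omega)
      have hpow : 2 ^ (s' 5 + 1) = 2 ^ s' 5 + 2 ^ s' 5 := by ring
      have a2 := i4 2 (by omega) (by omega)
      have a3 := i4 3 (by omega) (by omega)
      refine ⟨by omega, .add (2 ^ (s' 5 + 1)) (by omega) (by omega) (.add (s' 5 + 1)
        (by simp [a3, h3]) (by omega) (.sub (n - 2 ^ (s' 5 + 1)) (by simp [a2, h2]) (by omega)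
        (.nil ⟨by simp; omega, by simp, by simp, fun r hr hr' => ?_⟩)))⟩
      simp [hr', show r ≠ 10 by omega, show r ≠ 9 by omega, i4 r hr hr']
    · rintro s' ⟨i1, i2, i3, -⟩
      rw [add_zero] at i1
      rw [i3, i2, i1]
      omega
    · refine ⟨by simp [h5], by simp [h5], by simp, fun r hr hr' => ?_⟩
      simp [show r ≠ 10 by omega, show r ≠ 9 by omega]
    · exact ⟨by simpa using h.1, h.2.2.2⟩
  · omega

theorem distanceQuery_spec {V : Type u} [Finite V] {G : SimpleGraph V} (hG : IsMedianGraph G)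
    (ident : V ≃ Fin (Nat.card V)) {Λ : V → List Bool}
    (hΛ : IsLabeling (Nat.clog 2 (Nat.card V)) G (fun x => ident x) Λ) (u v : V) :
    RunsWithin (4 * (Nat.clog 2 (Nat.card V) + 1)) (labelTable ident Λ) distanceQuery
      (queryInput (ident u) (ident v) (Nat.card V)) (700 * (Nat.clog 2 (Nat.card V) + 1) ^ 4)
      fun s => s 0 = G.dist u v := by
  have hle : Nat.card V ≤ 2 ^ Nat.clog 2 (Nat.card V) := Nat.le_pow_clog (by norm_num) _
  have hn : 1 ≤ Nat.card V := (Nat.zero_le _).trans_lt (ident u).2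
  set w := Nat.clog 2 (Nat.card V) with hw
  have hwW : 2 ^ w < 2 ^ (4 * (w + 1)) := Nat.pow_lt_pow_right (by norm_num) (by omega)
  have hone := Nat.one_le_two_pow (n := w)
  have hdist := dist_lt_card hG.connected u v
  have hcomp := hΛ.computesDist (W := 4 * (w + 1)) (labels := labelTable ident Λ) (by omega)
    inferInstance hG (fun x y h => ident.injective (Fin.ext h)) fun x => (ident x).2.trans_le hle
  apply RunsWithin.le
  · refine .const (by omega) (.const (by omega) (.cons (T₁ := 5 * w + 4)
      (T₂ := (2 * w + 2) * (stepTime w + 1) + 3)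
      (computeWidth_spec (n := Nat.card V) hn (by omega) (by simp [queryInput]) (by simp)
        (by simp [queryInput])) ?_))
    rintro s1 ⟨j1, j2⟩
    have hs1 : Constants w s1 := ⟨by simp [j2], by simp [j2, queryInput], j1⟩
    have a7 : s1 7 = 0 := by simp [j2, queryInput]
    -- The level budget `2 * w` suffices because `2 ^ w * 2 ^ (2 * w) = 8 ^ w ≤ 9 ^ w = 3 ^ (2 *
    -- w)`.
    have hk : Nat.card V * 2 ^ (2 * w) ≤ 3 ^ (2 * w) := by
      calc Nat.card V * 2 ^ (2 * w) ≤ 2 ^ w * 2 ^ (2 * w) := Nat.mul_le_mul_right _ hle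
        _ = 8 ^ w := by rw [← pow_add, show w + 2 * w = 3 * w by ring, pow_mul]; norm_num
        _ ≤ 9 ^ w := Nat.pow_le_pow_left (by norm_num) w
        _ = 3 ^ (2 * w) := by rw [pow_mul]; norm_num
    -- Positions stay below `8 * (w + 1) ^ 3`, which fits into words of `4 * (w + 1)` bits.
    have hpos : 0 + (2 * w + 1) * (4 * (w + 1) ^ 2) < 2 ^ (4 * (w + 1)) := by
      have h1 : (w + 1) ^ 3 ≤ (2 ^ w) ^ 3 := Nat.pow_le_pow_left Nat.lt_two_pow_self 3
      have h2 : (2 ^ w) ^ 3 * 8 ≤ 2 ^ (4 * (w + 1)) := by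
        rw [← pow_mul, show (8 : ℕ) = 2 ^ 3 by norm_num, ← pow_add]
        exact Nat.pow_le_pow_right (by norm_num) (by omega)
      nlinarith
    have hloop := hcomp (2 * w) 0 s1 u v hk (fun x => ?_) hs1 (by simp [j2, queryInput])
      (by simp [j2, queryInput]) (by simp [j2, queryInput]) (by simp [j2]) hpos (by omega)
    -- The postcondition of the loop speaks of register `7` only, so register `4` is cleared again
    -- before it serves to copy the result.
    · refine .cons (T₁ := (2 * w + 2) * (stepTime w + 1)) (T₂ := 3) hloop fun s2 h2 =>
        .const (by omega) (.add (G.dist u v) (by simp [h2, a7]) (by omega) (.nil (by simp)))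
    · simp [labelTable]
  · rw [stepTime]
    nlinarith [Nat.zero_le (w ^ 4), Nat.zero_le (w ^ 3), Nat.zero_le (w ^ 2)]

end Query

/-- From `2 ^ (⌈log₂ n⌉ - 1) < n` and `log 2 > 1/2`. -/
theorem clog_two_le_two_mul_log (n : ℕ) (hn : 1 ≤ n) :
    (Nat.clog 2 n : ℝ) + 1 ≤ 2 * (1 + Real.log n) := by
  have hlog : 0 ≤ Real.log n := Real.log_nonneg (by exact_mod_cast hn)
  rcases hn.eq_or_lt with rfl | hn
  · simp
  · have hlt : 2 ^ (Nat.clog 2 n - 1) < n := Nat.pow_pred_clog_lt_self (by norm_num) hn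
    have hpos : 0 < Nat.clog 2 n := Nat.clog_pos (by norm_num) hn
    have h1 : Real.log ((2 : ℝ) ^ (Nat.clog 2 n - 1)) ≤ Real.log n :=
      Real.log_le_log (by positivity) (by exact_mod_cast hlt.le)
    rw [Real.log_pow, Nat.cast_sub (by omega), Nat.cast_one] at h1
    have h2 := Real.log_two_gt_d9
    have h3 : (0 : ℝ) ≤ (Nat.clog 2 n : ℝ) - 1 := by
      rw [sub_nonneg]
      exact_mod_cast hpos
    nlinarith

end MedianOracle
theorem mainTheorem3 :
    -- every median graph has a labeling produced by the recursive construction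
    (∀ (V : Type u) [Finite V] (G : SimpleGraph V), IsMedianGraph G →
      ∀ ident : V ≃ Fin (Nat.card V), ∃ Λ : V → List Bool,
        IsLabeling (Nat.clog 2 (Nat.card V)) G (fun x => ident x) Λ) ∧
    -- one program retrieves every distance from every such labeling in time `O(log⁴ n)`, on a
    -- machine with words of `O(log n)` bits
    (∃ (P : Prog) (c : ℕ) (C : ℝ),
      ∀ (V : Type u) [Finite V] (G : SimpleGraph V), IsMedianGraph G →
      ∀ (ident : V ≃ Fin (Nat.card V)) (Λ : V → List Bool),
        IsLabeling (Nat.clog 2 (Nat.card V)) G (fun x => ident x) Λ →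
      ∀ u v : V, ∃ (t : ℕ) (s : ℕ → ℕ),
        Runs (c * (Nat.clog 2 (Nat.card V) + 1)) (labelTable ident Λ) P
          (queryInput (ident u) (ident v) (Nat.card V)) t s ∧
        s 0 = G.dist u v ∧
        (t : ℝ) ≤ C * (1 + Real.log (Nat.card V) ^ 4)) ∧
    -- some shortest path passes successively through the fibers of the ladder sequence, via the
    -- median of `u`, `v`, `v₀`
    (∀ (V : Type u) [Finite V] (G : SimpleGraph V), IsMedianGraph G → IsUnbalanced G →
      ∀ v₀ : V, IsMedianVertex G v₀ → ∀ u v m : V, IsMedianOf G u v v₀ m →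
      ∀ (r t : ℕ) (L : ℤ → Set (ThetaClass G)),
        IsLadderSequence (ladder G v₀ u) (ladder G v₀ v) r t L →
      ∃ (p : G.Walk u v) (k : ℤ → ℕ), p.length = G.dist u v ∧ Monotone k ∧
        (∀ i : ℤ, -(r : ℤ) ≤ i → i ≤ t →
          k i ≤ p.length ∧ p.getVert (k i) ∈ ladderFiber G v₀ (L i)) ∧
        p.getVert (k 0) = m) := by
  refine ⟨fun V _ G hG ident => exists_isLabeling _ V G hG _, ⟨distanceQuery, 4, 700 * 128,
    fun V _ G hG ident Λ hΛ u v => ?_⟩, fun V _ G hG _ v₀ _ u v m hm r t L hL =>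
    hG.exists_walk_through_ladderSequence hm hL⟩
  obtain ⟨t, s, hrun, ht, hs⟩ := distanceQuery_spec hG ident hΛ u v
  refine ⟨t, s, hrun, hs, ?_⟩
  have hn : 1 ≤ Nat.card V := (Nat.zero_le _).trans_lt (ident u).2
  have hlog : 0 ≤ Real.log (Nat.card V) := Real.log_nonneg (by exact_mod_cast hn)
  have h1 := clog_two_le_two_mul_log _ hn
  set x := Real.log (Nat.card V)
  calc (t : ℝ) ≤ 700 * ((Nat.clog 2 (Nat.card V) : ℝ) + 1) ^ 4 := by exact_mod_cast ht
    _ ≤ 700 * (2 * (1 + x)) ^ 4 := by gcongr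
    -- The constant is `128 = 2⁴ * 8`, with `(1 + x)⁴ ≤ 8 * (1 + x⁴)` by convexity.
    _ ≤ 700 * 128 * (1 + x ^ 4) := by
      have h2 := add_pow_le (zero_le_one (α := ℝ)) hlog 4
      norm_num at h2
      rw [mul_pow]
      linarith
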